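/- **Lemma (very noisy channel, deadline $L=4$).** All logarithms are natural. A discrete memoryless channel with finite alphabets and transition probabilities $p(j|k)$ is called *$\eta$-noisy* if $p(j|k)=\omega_j(1+\epsilon_{jk})$, where $(\omega_j)$ is a probability distribution on the outputs, $\sum_j\omega_j\epsilon_{jk}=0$ for every input $k$, and $|\epsilon_{jk}|\le\eta$ for all $j,k$. The very noisy channel is the limit $\eta\to0$, in which exponents are compared to leading order, i.e. relative to the capacity $C$. *Feedback exponent.* With $$E_o(s,\rho,\mathbf p)=-\log\sum_y\Big(\sum_x p(x)p(y|x)^{1-s}\Big)\Big(\sum_x p(x)p(y|x)^{s/\rho}\Big)^{\rho},$$ $$E_x(s,\rho,\mathbf p)=-\rho\log\sum_{x,x_1}p(x)p(x_1)\Big(\sum_y p(y|x)^{1-s}p(y|x_1)^s\Big)^{1/\rho},$$ let $E_1(R,T)$ be the larger of $\sup_{0\le s\le\rho\le1,\,\mathbf p}\,[E_o(s,\rho,\mathbf p)-\rho R-sT]$ and $\sup_{0\le s\le1\le\rho,\,\mathbf p}\,[E_x(s,\rho,\mathbf p)-\rho R-sT]$, where $\mathbf p$ ranges over the input distributions and the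 point $s=\rho=0$ contributes $0$. Forney's feedback exponent is $E_F(R)=\lim_{E_1(R,T)\to0}T$, i.e. the least $T\ge0$ with $E_1(R,T)=0$. *IR-ARQ with deadline $L$.* One of $M$ equally likely messages is sent. Its codeword has $L$ blocks of $N$ symbols, all code symbols being i.i.d. with a capacity-achieving law. The blocks are sent one per round. After round $k<L$ the receiver uses all $kN$ received symbols and decides on message $m$ if $p(\mathbf y|\mathbf x_m)\ge e^{kNT_k}\sum_{i\ne m}p(\mathbf y|\mathbf x_i)$ (ties broken arbitrarily); if no message qualifies, it asks for the next block. After round $L$ it uses maximum likelihood decoding. Let $\Pr(E)$ be the average error probability and $\overline\tau$ the average decoding delay in channel uses, both also averaged over the random code. The exponent $E_{IR}(R,L)$ achieved at rate $R$ is the supremum of $\limsup_{N\to\infty}-\log\Pr(E)/\overline\tau$ over all choices of thresholds $T_k\ge0$ and message numbers $M=M_N\to\infty$ for which the average rate $\log M_N/\overline\tau$ tends to $R$. **Claim.** A deadline of $L=4$ suffices for IR-ARQ to achieve the feedback exponent on the very noisy channel at all rates $0\le R\le C$. Precisely: for every $\delta>0$ there is an $\eta>0$ such that for every $\eta$-noisy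 channel (with any finite alphabets), with capacity $C$, for every capacity-achieving input law used by IR-ARQ, and for all $0\le R\le C$, $$\big|E_F(R)-\big[(C-R)+(\sqrt C-\sqrt R)^2\big]\big|\le\delta C\qquad\text{and}\qquad E_{IR}(R,4)\ge E_F(R)-\delta C .$$ -/

import Mathlib

open Filter Topology

universe u v

noncomputable section

namespace ARQ

/-! ### Channels, capacity, very noisy channels

A discrete memoryless channel with finite input alphabet `X` and finite output alphabet `Y` is given
by its transition probabilities `W x y = p(y|x)`. All logarithms are natural. -/

/-- `W` is a channel whose outputs are almost independent of its inputs, at noise level `η`: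
`p(j|k) = ω_j (1 + ε_{jk})` for a probability distribution `ω` on the outputs and numbers `ε_{jk}`
with `∑_j ω_j ε_{jk} = 0` and `|ε_{jk}| ≤ η`. -/
def IsVeryNoisy {X : Type u} {Y : Type v} [Fintype Y] (η : ℝ) (W : X → Y → ℝ) : Prop :=
  ∃ (ω : Y → ℝ) (ε : Y → X → ℝ),
    (∀ j, 0 ≤ ω j) ∧ (∑ j, ω j = 1) ∧ (∀ k, ∑ j, ω j * ε j k = 0) ∧
    (∀ j k, |ε j k| ≤ η) ∧ ∀ k j, W k j = ω j * (1 + ε j k)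

/-- Mutual information (in nats) of the channel `W` under the input distribution `p`. -/
def mutualInfo {X : Type u} {Y : Type v} [Fintype X] [Fintype Y] (W : X → Y → ℝ) (p : X → ℝ) : ℝ :=
  ∑ x, ∑ y, p x * W x y * Real.log (W x y / ∑ x', p x' * W x' y)

/-- Channel capacity: the maximum of the mutual information over the input distributions. -/
def capacity {X : Type u} {Y : Type v} [Fintype X] [Fintype Y] (W : X → Y → ℝ) : ℝ :=
  sSup (mutualInfo W '' stdSimplex ℝ X)

/-- `p` is a capacity-achieving input distribution of `W`. -/
def IsCapacityAchieving {X : Type u} {Y : Type v} [Fintype X] [Fintype Y]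
    (W : X → Y → ℝ) (p : X → ℝ) : Prop :=
  p ∈ stdSimplex ℝ X ∧ mutualInfo W p = capacity W

/-! ### Forney's erasure exponent and the feedback exponent -/

/-- `E_o(s, ρ, p) = -log ∑_y (∑_x p(x) p(y|x)^{1-s}) (∑_x p(x) p(y|x)^{s/ρ})^ρ`. -/
def Eo {X : Type u} {Y : Type v} [Fintype X] [Fintype Y] (W : X → Y → ℝ)
    (s ρ : ℝ) (p : X → ℝ) : ℝ :=
  -Real.log (∑ y, (∑ x, p x * W x y ^ (1 - s)) * (∑ x, p x * W x y ^ (s / ρ)) ^ ρ)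

/-- `E_x(s, ρ, p) = -ρ log ∑_{x, x₁} p(x) p(x₁) (∑_y p(y|x)^{1-s} p(y|x₁)^s)^{1/ρ}`. -/
def Ex {X : Type u} {Y : Type v} [Fintype X] [Fintype Y] (W : X → Y → ℝ)
    (s ρ : ℝ) (p : X → ℝ) : ℝ :=
  -ρ * Real.log (∑ x, ∑ x₁, p x * p x₁ * (∑ y, W x y ^ (1 - s) * W x₁ y ^ s) ^ (1 / ρ))

/-- The erasure exponent `E_1(R, T)`: the larger of the random coding expression (which is the
larger one at high rates) and the expurgated expression (low rates). The point `s = ρ = 0`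
contributes the value `0` to the first one, so that `E_1(R, T) ≥ 0`. -/
def E1 {X : Type u} {Y : Type v} [Fintype X] [Fintype Y] (W : X → Y → ℝ) (R T : ℝ) : EReal :=
  sSup {e : EReal | ∃ (s ρ : ℝ) (p : X → ℝ), 0 ≤ s ∧ s ≤ ρ ∧ ρ ≤ 1 ∧ p ∈ stdSimplex ℝ X ∧
      e = ((Eo W s ρ p - ρ * R - s * T : ℝ) : EReal)} ⊔
  sSup {e : EReal | ∃ (s ρ : ℝ) (p : X → ℝ), 0 ≤ s ∧ s ≤ 1 ∧ 1 ≤ ρ ∧ p ∈ stdSimplex ℝ X ∧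
      e = ((Ex W s ρ p - ρ * R - s * T : ℝ) : EReal)}

/-- The feedback exponent `E_F(R) = lim_{E_1(R,T) → 0} T`. As a function of `T ≥ 0`, `E_1(R, T)` is
nonnegative, convex and nonincreasing, so that the limit is the least `T ≥ 0` at which `E_1(R, T)`
vanishes. -/
def feedbackExponent {X : Type u} {Y : Type v} [Fintype X] [Fintype Y]
    (W : X → Y → ℝ) (R : ℝ) : EReal :=
  sInf {e : EReal | ∃ T : ℝ, 0 ≤ T ∧ E1 W R T = 0 ∧ e = (T : EReal)}

/-! ### Incremental redundancy ARQ with a deadline of `L` rounds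

There are `L` rounds of `N` symbols. A codeword and a received sequence are indexed by the round and
the position in the round. New code symbols are used in each round. -/

/-- `p(y|x)` for the received sequence and the codeword of the first `k` rounds (`kN` symbols). -/
def likelihood {X : Type u} {Y : Type v} {L N : ℕ} (W : X → Y → ℝ) (k : ℕ)
    (x : Fin L → Fin N → X) (y : Fin L → Fin N → Y) : ℝ :=
  ∏ r ∈ Finset.univ.filter (fun r : Fin L => r.val < k), ∏ i, W (x r i) (y r i)

/-- The received sequence of the first `k` rounds lies in the decision region of message `m`:
`p(y|x_m) / ∑_{i ≠ m} p(y|x_i) ≥ e^{kNt}`. -/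
def InRegion {X : Type u} {Y : Type v} {M L N : ℕ} (W : X → Y → ℝ) (k : ℕ) (t : ℝ)
    (c : Fin M → Fin L → Fin N → X) (y : Fin L → Fin N → Y) (m : Fin M) : Prop :=
  Real.exp (k * N * t) * ∑ i ∈ Finset.univ.erase m, likelihood W k (c i) y
    ≤ likelihood W k (c m) y

open Classical in
/-- The erasure decoder after `k` rounds, with threshold `t`; `none` is an erasure. -/
def erasureDecode {X : Type u} {Y : Type v} {M L N : ℕ} (W : X → Y → ℝ) (k : ℕ) (t : ℝ)
    (c : Fin M → Fin L → Fin N → X) (y : Fin L → Fin N → Y) : Option (Fin M) :=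
  if h : ∃ m, InRegion W k t c y m then some h.choose else none

open Classical in
/-- The maximum likelihood decoder after all `L` rounds (it never erases, unless `M = 0`). -/
def mlDecode {X : Type u} {Y : Type v} {M L N : ℕ} (W : X → Y → ℝ)
    (c : Fin M → Fin L → Fin N → X) (y : Fin L → Fin N → Y) : Option (Fin M) :=
  if h : ∃ m, ∀ i, likelihood W L (c i) y ≤ likelihood W L (c m) y then some h.choose else none

/-- The number of ARQ rounds that are used: the first `k ∈ {1, …, L-1}` for which the erasure
decoder (with threshold `T k` after `k` rounds) does not erase, and `L` if there is none. -/
def rounds {X : Type u} {Y : Type v} {M L N : ℕ} (W : X → Y → ℝ) (T : ℕ → ℝ)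
    (c : Fin M → Fin L → Fin N → X) (y : Fin L → Fin N → Y) : ℕ :=
  sInf {k : ℕ | (1 ≤ k ∧ k < L ∧ erasureDecode W k (T k) c y ≠ none) ∨ k = L}

/-- The final decision of the receiver: the decision of the erasure decoder if it stops before the
`L`-th round, and the maximum likelihood decision otherwise. -/
def decision {X : Type u} {Y : Type v} {M L N : ℕ} (W : X → Y → ℝ) (T : ℕ → ℝ)
    (c : Fin M → Fin L → Fin N → X) (y : Fin L → Fin N → Y) : Option (Fin M) :=
  if rounds W T c y < L then erasureDecode W (rounds W T c y) (T (rounds W T c y)) c y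
  else mlDecode W c y

/-- Expectation of a function of the codebook, the message and the channel outputs: all code symbols
are i.i.d. with law `p`, the message is uniform on `M` values, and the channel is memoryless.
(Outputs are drawn for all `L` rounds; those after the last round used have no influence.) -/
def mean {X : Type u} {Y : Type v} [Fintype X] [Fintype Y] (W : X → Y → ℝ) (p : X → ℝ)
    {M L N : ℕ} (f : (Fin M → Fin L → Fin N → X) → Fin M → (Fin L → Fin N → Y) → ℝ) : ℝ :=
  ∑ c : Fin M → Fin L → Fin N → X, (∏ m, ∏ r, ∏ i, p (c m r i)) *
    ((1 / (M : ℝ)) * ∑ m, ∑ y : Fin L → Fin N → Y, likelihood W L (c m) y * f c m y)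

open Classical in
/-- Average probability of error of IR-ARQ. -/
def prError {X : Type u} {Y : Type v} [Fintype X] [Fintype Y] (W : X → Y → ℝ) (p : X → ℝ)
    (L N M : ℕ) (T : ℕ → ℝ) : ℝ :=
  mean W p (M := M) (L := L) (N := N) fun c m y => if decision W T c y = some m then 0 else 1

/-- Average decoding delay of IR-ARQ, in channel uses. -/
def avgDelay {X : Type u} {Y : Type v} [Fintype X] [Fintype Y] (W : X → Y → ℝ) (p : X → ℝ)
    (L N M : ℕ) (T : ℕ → ℝ) : ℝ :=
  mean W p (M := M) (L := L) (N := N) fun c _ y => (N : ℝ) * (rounds W T c y : ℝ)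

/-- `E_IR(R, L)`: the error exponent achieved by IR-ARQ with deadline `L` at rate `R` when the code
symbols are drawn i.i.d. from `p`. It is the supremum of `limsup_N -log Pr(E) / τ̄` over the numbers
`M N` of messages (`M N → ∞`, which matters only for `R = 0`) and the thresholds `T k ≥ 0` for which
the average rate `log (M N) / τ̄` tends to `R`. -/
def irExponent {X : Type u} {Y : Type v} [Fintype X] [Fintype Y] (W : X → Y → ℝ) (p : X → ℝ)
    (R : ℝ) (L : ℕ) : EReal :=
  sSup {e : EReal | ∃ (M : ℕ → ℕ) (T : ℕ → ℝ), (∀ k, 0 ≤ T k) ∧ Tendsto M atTop atTop ∧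
    Tendsto (fun N => Real.log (M N) / avgDelay W p L N (M N) T) atTop (𝓝 R) ∧
    e = limsup (fun N => (-ENNReal.log (ENNReal.ofReal (prError W p L N (M N) T))) /
      ((avgDelay W p L N (M N) T : ℝ) : EReal)) atTop}

end ARQ

end

noncomputable section

namespace ARQ

/-! ### Second order bounds on elementary functions near `1` -/

/-! Relative to the output law `q` induced by an input law `p`, a very noisy channel is `q (1 + e)`,
where the small deviation `e` has mean zero both over inputs (under `p`) and over outputs (under
`q`). Linear terms therefore cancel, and everything is governed by V, half the mean square of `e`:
the mutual information is about V, `Eo` is about s(2 - s - s/ρ)V and `Ex` is at most about 2s(1 -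
s)V, all with small relative error. Since V is essentially at most C for every input law and
essentially equal to C for a capacity-achieving one, V may be replaced by C (`HasNoisyExponents`).

Feedback exponent: put w = s/ρ. Divided by ρ, the random coding expression is about w(2 - s - w)C -
R - wT. For small s it is positive when T < (2 - w)C - R/w, and the best choice w = √(R/C) turns
this into T < 2C - 2√(CR) = (C - R) + (√C - √R)². Completing a square shows that neither expression
is positive above this value, up to the error terms (`exists_exponent_parameters`,
`HasNoisyExponents.E1_eq_zero`).

Achievability: only the first and the last round ever decode. With log M about NR and a first
threshold t just below the feedback exponent, the erasure exponent is positive, so the first round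
almost always suffices and the mean delay is asymptotic to N. An undetected error in the first round
has probability at most e^{-Nt} (`mean_undetected_le`). Maximum likelihood over four rounds fails
with exponent at least 4 Eo(1/2, 1) - R, about 4(C/2) - R = 2C - R, which is at least 2C - 2√(CR)
because R ≤ C (`mean_indicator_le`). Both error terms thus reach the feedback exponent; this is
where four rounds are used. -/

theorem quadratic_le {f f' f'' : ℝ → ℝ} {θ m : ℝ}
    (hf : ∀ x, |x| ≤ θ → HasDerivAt f (f' x) x) (hf' : ∀ x, |x| ≤ θ → HasDerivAt f' (f'' x) x)
    (hm : ∀ x, |x| ≤ θ → m ≤ f'' x) {x : ℝ} (hx : |x| ≤ θ) :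
    f 0 + f' 0 * x + m / 2 * x ^ 2 ≤ f x := by
  have hθ : 0 ≤ θ := (abs_nonneg x).trans hx
  -- What remains after subtracting the parabola is convex, hence lies above its tangent at 0.
  have hconv : ConvexOn ℝ (Set.Icc (-θ) θ) (fun x => f x - m / 2 * x ^ 2) := by
    have hd : ∀ x, |x| ≤ θ → HasDerivAt (fun x => f x - m / 2 * x ^ 2) (f' x - m * x) x := by
      intro x hx
      have := (hf x hx).sub (((hasDerivAt_id x).pow 2).const_mul (m / 2))
      refine this.congr_deriv ?_
      simp; ring
    have hd' : ∀ x, |x| ≤ θ → HasDerivAt (fun x => f' x - m * x) (f'' x - m) x := by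
      intro x hx
      have := (hf' x hx).sub ((hasDerivAt_id x).const_mul m)
      refine this.congr_deriv ?_
      simp
    refine convexOn_of_hasDerivWithinAt2_nonneg (convex_Icc _ _)
      (f' := fun x => f' x - m * x) (f'' := fun x => f'' x - m) ?_ ?_ ?_ ?_
    · exact fun x hx => (hd x (abs_le.2 hx)).continuousAt.continuousWithinAt
    · exact fun x hx => (hd x (abs_le.2 (Set.mem_Icc.1 (interior_subset hx)))).hasDerivWithinAt
    · exact fun x hx => (hd' x (abs_le.2 (Set.mem_Icc.1 (interior_subset hx)))).hasDerivWithinAt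
    · exact fun x hx => sub_nonneg.2 (hm x (abs_le.2 (Set.mem_Icc.1 (interior_subset hx))))
  have h0 : |(0 : ℝ)| ≤ θ := by simpa using hθ
  have hg : HasDerivAt (fun x => f x - m / 2 * x ^ 2) (f' 0) 0 := by
    have := (hf 0 h0).sub (((hasDerivAt_id (0 : ℝ)).pow 2).const_mul (m / 2))
    refine this.congr_deriv ?_
    simp
  rcases lt_trichotomy x 0 with hlt | rfl | hgt
  · have := hconv.slope_le_of_hasDerivAt (abs_le.1 hx) (abs_le.1 h0) hlt hg
    rw [slope_def_field, div_le_iff₀ (by linarith)] at this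
    nlinarith
  · simp
  · have := hconv.le_slope_of_hasDerivAt (abs_le.1 h0) (abs_le.1 hx) hgt hg
    rw [slope_def_field, le_div_iff₀ (by linarith)] at this
    nlinarith

theorem le_quadratic {f f' f'' : ℝ → ℝ} {θ m : ℝ}
    (hf : ∀ x, |x| ≤ θ → HasDerivAt f (f' x) x) (hf' : ∀ x, |x| ≤ θ → HasDerivAt f' (f'' x) x)
    (hm : ∀ x, |x| ≤ θ → f'' x ≤ m) {x : ℝ} (hx : |x| ≤ θ) :
    f x ≤ f 0 + f' 0 * x + m / 2 * x ^ 2 := by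
  have := quadratic_le (f := fun x => -f x) (f' := fun x => -f' x) (f'' := fun x => -f'' x)
    (m := -m) (fun x hx => (hf x hx).neg) (fun x hx => (hf' x hx).neg)
    (fun x hx => neg_le_neg (hm x hx)) hx
  linarith

theorem hasDerivAt_one_add_rpow (a : ℝ) {x : ℝ} (hx : 0 < 1 + x) :
    HasDerivAt (fun x : ℝ => (1 + x) ^ a) (a * (1 + x) ^ (a - 1)) x := by
  have := ((hasDerivAt_id x).const_add 1).rpow_const (p := a) (Or.inl hx.ne')
  simpa using this

/-- The exponent a - 2 lies between -2 and 0, so the power is squeezed between 1 and (1 + x)^(-2),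
uniformly in a. -/
theorem rpow_sub_two_bounds {a θ x : ℝ} (ha : 0 ≤ a) (ha1 : a ≤ 1) (hθ : θ ≤ 1 / 4)
    (hx : |x| ≤ θ) : 1 - 3 * θ ≤ (1 + x) ^ (a - 2) ∧ (1 + x) ^ (a - 2) ≤ 1 + 4 * θ := by
  obtain ⟨h1, h2⟩ := abs_le.1 hx
  have hpos : 0 < 1 + x := by linarith
  have hθ0 : 0 ≤ θ := (abs_nonneg x).trans hx
  have hinv : ∀ b : ℝ, b ≤ 0 → -2 ≤ b → 1 - 3 * θ ≤ (1 + x) ^ b ∧ (1 + x) ^ b ≤ 1 + 4 * θ := by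
    intro b hb hb2
    have e2 : ∀ z : ℝ, z ^ (-2 : ℝ) = (z ^ 2)⁻¹ := fun z => by
      rw [show (-2 : ℝ) = ((-2 : ℤ) : ℝ) by norm_num, Real.rpow_intCast, zpow_neg]; rfl
    have hl : 1 - 3 * θ ≤ ((1 + θ) ^ 2)⁻¹ := by
      rw [← one_div, le_div_iff₀ (by positivity)]
      nlinarith [mul_nonneg hθ0 hθ0, mul_nonneg hθ0 (mul_nonneg hθ0 hθ0)]
    have hu : ((1 - θ) ^ 2)⁻¹ ≤ 1 + 4 * θ := by
      have : 0 < 1 - θ := by linarith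
      rw [← one_div, div_le_iff₀ (by positivity)]
      nlinarith [mul_nonneg hθ0 (mul_nonneg hθ0 hθ0), mul_nonneg hθ0 (sub_nonneg.2 hθ)]
    rcases le_total 0 x with h | h
    · constructor
      · calc _ ≤ ((1 + θ) ^ 2)⁻¹ := hl
          _ ≤ ((1 + x) ^ 2)⁻¹ := by gcongr
          _ = (1 + x) ^ (-2 : ℝ) := (e2 _).symm
          _ ≤ _ := Real.rpow_le_rpow_of_exponent_le (by linarith) hb2
      · have := Real.rpow_le_one_of_one_le_of_nonpos (x := 1 + x) (by linarith) hb
        linarith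
    · constructor
      · have := Real.one_le_rpow_of_pos_of_le_one_of_nonpos (x := 1 + x) hpos (by linarith) hb
        linarith
      · calc _ ≤ (1 + x) ^ (-2 : ℝ) :=
              Real.rpow_le_rpow_of_exponent_ge hpos (by linarith) hb2
          _ = ((1 + x) ^ 2)⁻¹ := e2 _
          _ ≤ ((1 - θ) ^ 2)⁻¹ := by
            have : 0 < 1 - θ := by linarith
            gcongr; linarith
          _ ≤ _ := hu
  exact hinv _ (by linarith) (by linarith)

/-- The factor a(1 - a) of the second derivative is kept exact, so that the error is relative. This
matters because the feedback exponent is approached with s and ρ small, where an absolute error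
would swamp the main term. -/
theorem one_add_rpow_bounds {a θ x : ℝ} (ha : 0 ≤ a) (ha1 : a ≤ 1) (hθ : θ ≤ 1 / 4)
    (hx : |x| ≤ θ) :
    1 + a * x - a * (1 - a) / 2 * (1 + 4 * θ) * x ^ 2 ≤ (1 + x) ^ a ∧
      (1 + x) ^ a ≤ 1 + a * x - a * (1 - a) / 2 * (1 - 4 * θ) * x ^ 2 := by
  have hθ0 : 0 ≤ θ := (abs_nonneg x).trans hx
  have hpos : ∀ x, |x| ≤ θ → 0 < 1 + x := fun x hx => by linarith [(abs_le.1 hx).1]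
  have h1 : ∀ x, |x| ≤ θ → HasDerivAt (fun x : ℝ => (1 + x) ^ a) (a * (1 + x) ^ (a - 1)) x :=
    fun x hx => hasDerivAt_one_add_rpow a (hpos x hx)
  have h2 : ∀ x, |x| ≤ θ → HasDerivAt (fun x : ℝ => a * (1 + x) ^ (a - 1))
      (-(a * (1 - a)) * (1 + x) ^ (a - 2)) x := fun x hx => by
    refine ((hasDerivAt_one_add_rpow (a - 1) (hpos x hx)).const_mul a).congr_deriv ?_
    rw [show a - 1 - 1 = a - 2 by ring]; ring
  have haa : 0 ≤ a * (1 - a) := mul_nonneg ha (by linarith)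
  constructor
  · have := quadratic_le h1 h2 (m := -(a * (1 - a)) * (1 + 4 * θ)) (fun x hx => by
      nlinarith [mul_le_mul_of_nonneg_left (rpow_sub_two_bounds ha ha1 hθ hx).2 haa]) hx
    simp only [add_zero, Real.one_rpow] at this
    linarith
  · have := le_quadratic h1 h2 (m := -(a * (1 - a)) * (1 - 4 * θ)) (fun x hx => by
      nlinarith [mul_le_mul_of_nonneg_left (rpow_sub_two_bounds ha ha1 hθ hx).1 haa,
        mul_nonneg haa hθ0]) hx
    simp only [add_zero, Real.one_rpow] at this
    linarith

theorem one_add_mul_log_bounds {θ x : ℝ} (hθ : θ ≤ 1 / 4) (hx : |x| ≤ θ) :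
    x + (1 - 4 * θ) / 2 * x ^ 2 ≤ (1 + x) * Real.log (1 + x) ∧
      (1 + x) * Real.log (1 + x) ≤ x + (1 + 4 * θ) / 2 * x ^ 2 := by
  have hθ0 : 0 ≤ θ := (abs_nonneg x).trans hx
  have hpos : ∀ x, |x| ≤ θ → 0 < 1 + x := fun x hx => by linarith [(abs_le.1 hx).1]
  have hlog : ∀ x, |x| ≤ θ → HasDerivAt (fun x : ℝ => Real.log (1 + x)) (1 + x)⁻¹ x :=
    fun x hx => by
      have := ((hasDerivAt_id x).const_add 1).log (hpos x hx).ne'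
      simpa using this
  have h1 : ∀ x, |x| ≤ θ → HasDerivAt (fun x : ℝ => (1 + x) * Real.log (1 + x))
      (Real.log (1 + x) + 1) x := fun x hx => by
    refine (((hasDerivAt_id x).const_add 1).mul (hlog x hx)).congr_deriv ?_
    simp [mul_inv_cancel₀ (hpos x hx).ne']
  have h2 : ∀ x, |x| ≤ θ → HasDerivAt (fun x : ℝ => Real.log (1 + x) + 1) (1 + x)⁻¹ x :=
    fun x hx => (hlog x hx).add_const 1
  constructor
  · have := quadratic_le h1 h2 (m := 1 - 4 * θ) (fun x hx => by
      have := hpos x hx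
      rw [← one_div, le_div_iff₀ this]
      nlinarith [(abs_le.1 hx).1, (abs_le.1 hx).2]) hx
    simp at this
    linarith
  · have := le_quadratic h1 h2 (m := 1 + 4 * θ) (fun x hx => by
      have := hpos x hx
      rw [← one_div, div_le_iff₀ this]
      nlinarith [(abs_le.1 hx).1, (abs_le.1 hx).2]) hx
    simp at this
    linarith

/-- From log u ≥ 1 - 1/u; the loss is again a relative factor. -/
theorem neg_log_le_of_one_sub_le {x z θ : ℝ} (hθ : θ ≤ 1 / 4) (hz : 0 ≤ z) (hzθ : z ≤ θ)
    (h : 1 - z ≤ x) : -Real.log x ≤ z * (1 + 2 * θ) := by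
  have h1 : 0 < 1 - z := by linarith
  have h2 := Real.one_sub_inv_le_log_of_pos h1
  have h3 := Real.log_le_log h1 h
  have h4 : (1 - z)⁻¹ ≤ 1 + z * (1 + 2 * θ) := by
    rw [← one_div, div_le_iff₀ h1]
    nlinarith [mul_nonneg hz (sub_nonneg.2 hzθ), mul_nonneg hz hz,
      mul_nonneg hz (mul_nonneg (hz.trans hzθ) (by linarith : 0 ≤ 1 / 4 - z))]
  linarith

theorem sum_mul_log_le {ι : Type*} [Fintype ι] {w z : ι → ℝ} (hw : ∀ i, 0 ≤ w i)
    (hw1 : ∑ i, w i = 1) (hz : ∀ i, 0 < z i) :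
    ∑ i, w i * Real.log (z i) ≤ Real.log (∑ i, w i * z i) := by
  have := strictConcaveOn_log_Ioi.concaveOn.le_map_sum (t := Finset.univ) (w := w) (p := z)
    (fun i _ => hw i) hw1 (fun i _ => hz i)
  simpa [smul_eq_mul] using this

/-! ### Channels written relative to the output distribution -/

section Centered

variable {X : Type u} {Y : Type v} [Fintype X] [Fintype Y]

/-- `W x y = q y (1 + e x y)`, where `q` is the output distribution under the input distribution
`p`, and `|e| ≤ θ`. -/
structure IsCentered (W : X → Y → ℝ) (p : X → ℝ) (q : Y → ℝ) (e : X → Y → ℝ) (θ : ℝ) : Prop where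
  mem : p ∈ stdSimplex ℝ X
  nonneg : ∀ y, 0 ≤ q y
  sum_eq : ∑ y, q y = 1
  eq : ∀ x y, W x y = q y * (1 + e x y)
  sum_out : ∀ x, ∑ y, q y * e x y = 0
  sum_in : ∀ y, ∑ x, p x * e x y = 0
  bound : ∀ x y, |e x y| ≤ θ

/-- Recentring: with m the `p`-mean of ε, the output law is ω(1 + m) and the deviation becomes (ε -
m)/(1 + m), of size at most 2η/(1 - η) ≤ 4η. The linear terms then vanish under averaging over
inputs. -/
theorem IsVeryNoisy.exists_isCentered {W : X → Y → ℝ} {η : ℝ} (hη : η ≤ 1 / 2)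
    (hW : IsVeryNoisy η W) {p : X → ℝ} (hp : p ∈ stdSimplex ℝ X) :
    ∃ q e, IsCentered W p q e (4 * η) := by
  obtain ⟨ω, ε, hω, hω1, hsum, hε, hW⟩ := hW
  set m : Y → ℝ := fun y => ∑ x, p x * ε y x with hm
  have hp0 := hp.1
  have hp1 := hp.2
  have hmabs : ∀ y, |m y| ≤ η := fun y => by
    calc |m y| ≤ ∑ x, |p x * ε y x| := Finset.abs_sum_le_sum_abs _ _
      _ ≤ ∑ x, p x * η := Finset.sum_le_sum fun x _ => by
          rw [abs_mul, abs_of_nonneg (hp0 x)]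
          exact mul_le_mul_of_nonneg_left (hε y x) (hp0 x)
      _ = η := by rw [← Finset.sum_mul, hp1, one_mul]
  have hpos : ∀ y, 0 < 1 + m y := fun y => by
    linarith [(abs_le.1 (hmabs y)).1]
  have hω_m : ∑ y, ω y * m y = 0 := by
    simp only [hm, Finset.mul_sum]
    rw [Finset.sum_comm]
    refine Finset.sum_eq_zero fun x _ => ?_
    rw [← mul_zero (p x), ← hsum x, Finset.mul_sum]
    exact Finset.sum_congr rfl fun y _ => by ring
  refine ⟨fun y => ω y * (1 + m y), fun x y => (ε y x - m y) / (1 + m y), hp, ?_, ?_, ?_, ?_, ?_, ?_⟩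
  · exact fun y => mul_nonneg (hω y) (hpos y).le
  · simp only [mul_add, mul_one, Finset.sum_add_distrib, hω1, hω_m, add_zero]
  · intro x y
    have := (hpos y).ne'
    rw [hW]; field_simp; ring
  · intro x
    have : ∀ y, ω y * (1 + m y) * ((ε y x - m y) / (1 + m y)) = ω y * ε y x - ω y * m y := by
      intro y
      have := (hpos y).ne'
      field_simp
    simp only [this, Finset.sum_sub_distrib, hsum, hω_m, sub_zero]
  · intro y
    simp only [mul_div_assoc', ← Finset.sum_div, mul_sub, Finset.sum_sub_distrib, ← Finset.sum_mul,
      hp1, one_mul]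
    simp [hm]
  · intro x y
    rw [abs_div, abs_of_pos (hpos y), div_le_iff₀ (hpos y), abs_le]
    have h1 := abs_le.1 (hε y x)
    have h2 := abs_le.1 (hmabs y)
    have h3 : 0 ≤ η := (abs_nonneg _).trans (hmabs y)
    constructor <;> nlinarith

/-- Half of the mean square of the relative deviation `e`. -/
def halfVar (p : X → ℝ) (q : Y → ℝ) (e : X → Y → ℝ) : ℝ :=
  ∑ y, q y * ((∑ x, p x * e x y ^ 2) / 2)

/-! ### Mutual information and exponent functions to second order in the deviation. -/

namespace IsCentered

variable {W : X → Y → ℝ} {p : X → ℝ} {q : Y → ℝ} {e : X → Y → ℝ} {θ : ℝ}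

theorem bound_nonneg (h : IsCentered W p q e θ) : 0 ≤ θ := by
  have hX : ∃ x, p x ≠ 0 := by
    by_contra! h0
    have := h.mem.2
    simp [h0] at this
  have hY : ∃ y, q y ≠ 0 := by
    by_contra! h0
    have := h.sum_eq
    simp [h0] at this
  obtain ⟨x, -⟩ := hX
  obtain ⟨y, -⟩ := hY
  exact (abs_nonneg _).trans (h.bound x y)

theorem sq_le (h : IsCentered W p q e θ) (x : X) (y : Y) : e x y ^ 2 ≤ θ ^ 2 :=
  sq_le_sq' (abs_le.1 (h.bound x y)).1 (abs_le.1 (h.bound x y)).2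

theorem var_nonneg (h : IsCentered W p q e θ) (y : Y) : 0 ≤ (∑ x, p x * e x y ^ 2) / 2 :=
  div_nonneg (Finset.sum_nonneg fun x _ => mul_nonneg (h.mem.1 x) (sq_nonneg _)) (by norm_num)

theorem var_le (h : IsCentered W p q e θ) (y : Y) : (∑ x, p x * e x y ^ 2) / 2 ≤ θ ^ 2 / 2 := by
  have : ∑ x, p x * e x y ^ 2 ≤ ∑ x, p x * θ ^ 2 :=
    Finset.sum_le_sum fun x _ => mul_le_mul_of_nonneg_left (h.sq_le x y) (h.mem.1 x)
  rw [← Finset.sum_mul, h.mem.2, one_mul] at this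
  linarith

theorem halfVar_nonneg (h : IsCentered W p q e θ) : 0 ≤ halfVar p q e :=
  Finset.sum_nonneg fun y _ => mul_nonneg (h.nonneg y) (h.var_nonneg y)

theorem halfVar_le (h : IsCentered W p q e θ) : halfVar p q e ≤ θ ^ 2 / 2 := by
  have : halfVar p q e ≤ ∑ y, q y * (θ ^ 2 / 2) :=
    Finset.sum_le_sum fun y _ => mul_le_mul_of_nonneg_left (h.var_le y) (h.nonneg y)
  rwa [← Finset.sum_mul, h.sum_eq, one_mul] at this

theorem one_add_pos (h : IsCentered W p q e θ) (hθ : θ ≤ 1 / 12) (x : X) (y : Y) :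
    0 < 1 + e x y := by
  linarith [(abs_le.1 (h.bound x y)).1]

theorem output_eq (h : IsCentered W p q e θ) (y : Y) : ∑ x, p x * W x y = q y := by
  have : ∀ x, p x * W x y = q y * p x + q y * (p x * e x y) := fun x => by rw [h.eq]; ring
  simp only [this, Finset.sum_add_distrib, ← Finset.mul_sum, h.sum_in, h.mem.2, mul_one, mul_zero,
    add_zero]

theorem sum_quadratic (h : IsCentered W p q e θ) (a k : ℝ) (y : Y) :
    ∑ x, p x * (1 + a * e x y - k * e x y ^ 2) = 1 - 2 * k * ((∑ x, p x * e x y ^ 2) / 2) := by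
  have : ∀ x, p x * (1 + a * e x y - k * e x y ^ 2)
      = p x + a * (p x * e x y) - k * (p x * e x y ^ 2) := fun x => by ring
  simp only [this, Finset.sum_add_distrib, Finset.sum_sub_distrib, ← Finset.mul_sum, h.sum_in,
    h.mem.2]
  ring

theorem mutualInfo_eq (h : IsCentered W p q e θ) :
    mutualInfo W p = ∑ y, q y * ∑ x, p x * ((1 + e x y) * Real.log (1 + e x y)) := by
  simp only [mutualInfo, h.output_eq]
  rw [Finset.sum_comm]
  refine Finset.sum_congr rfl fun y _ => ?_
  rw [Finset.mul_sum]
  refine Finset.sum_congr rfl fun x _ => ?_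
  rcases eq_or_ne (q y) 0 with h0 | h0
  · simp [h.eq, h0]
  · rw [h.eq, mul_div_cancel_left₀ _ h0]; ring

theorem mutualInfo_bounds (h : IsCentered W p q e θ) (hθ : θ ≤ 1 / 12) :
    (1 - 4 * θ) * halfVar p q e ≤ mutualInfo W p ∧
      mutualInfo W p ≤ (1 + 4 * θ) * halfVar p q e := by
  rw [h.mutualInfo_eq, halfVar, Finset.mul_sum, Finset.mul_sum]
  have key : ∀ k y, ∑ x, p x * (e x y + k / 2 * e x y ^ 2)
      = k * ((∑ x, p x * e x y ^ 2) / 2) := fun k y => by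
    have : ∀ x, p x * (e x y + k / 2 * e x y ^ 2)
      = (p x * e x y) + k / 2 * (p x * e x y ^ 2) := fun x => by ring
    simp only [this, Finset.sum_add_distrib, ← Finset.mul_sum, h.sum_in]
    ring
  constructor
  · refine Finset.sum_le_sum fun y _ => ?_
    rw [mul_left_comm, ← key]
    exact mul_le_mul_of_nonneg_left (Finset.sum_le_sum fun x _ => mul_le_mul_of_nonneg_left
      (one_add_mul_log_bounds (by linarith) (h.bound x y)).1 (h.mem.1 x)) (h.nonneg y)
  · refine Finset.sum_le_sum fun y _ => ?_
    rw [mul_left_comm, ← key]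
    exact mul_le_mul_of_nonneg_left (Finset.sum_le_sum fun x _ => mul_le_mul_of_nonneg_left
      (one_add_mul_log_bounds (by linarith) (h.bound x y)).2 (h.mem.1 x)) (h.nonneg y)

theorem sum_rpow_bounds (h : IsCentered W p q e θ) (hθ : θ ≤ 1 / 12) {a : ℝ} (ha : 0 ≤ a)
    (ha1 : a ≤ 1) (y : Y) :
    1 - a * (1 - a) * (1 + 4 * θ) * ((∑ x, p x * e x y ^ 2) / 2) ≤ ∑ x, p x * (1 + e x y) ^ a ∧
      ∑ x, p x * (1 + e x y) ^ a ≤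
        1 - a * (1 - a) * (1 - 4 * θ) * ((∑ x, p x * e x y ^ 2) / 2) := by
  constructor
  · refine le_trans (le_of_eq ?_) (Finset.sum_le_sum fun x _ => mul_le_mul_of_nonneg_left
      (one_add_rpow_bounds ha ha1 (by linarith) (h.bound x y)).1 (h.mem.1 x))
    rw [h.sum_quadratic]; ring
  · refine le_trans (Finset.sum_le_sum fun x _ => mul_le_mul_of_nonneg_left
      (one_add_rpow_bounds ha ha1 (by linarith) (h.bound x y)).2 (h.mem.1 x)) (le_of_eq ?_)
    rw [h.sum_quadratic]; ring

theorem Eo_eq (h : IsCentered W p q e θ) (hθ : θ ≤ 1 / 12) {s ρ : ℝ} (hs : 0 ≤ s) (hsρ : s ≤ ρ) :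
    Eo W s ρ p = -Real.log (∑ y, q y * ((∑ x, p x * (1 + e x y) ^ (1 - s)) *
      (∑ x, p x * (1 + e x y) ^ (s / ρ)) ^ ρ)) := by
  rw [Eo]
  congr 2
  refine Finset.sum_congr rfl fun y _ => ?_
  have h1 : ∀ a : ℝ, ∑ x, p x * W x y ^ a = q y ^ a * ∑ x, p x * (1 + e x y) ^ a := fun a => by
    rw [Finset.mul_sum]
    refine Finset.sum_congr rfl fun x _ => ?_
    rw [h.eq, Real.mul_rpow (h.nonneg y) (h.one_add_pos hθ x y).le]; ring
  have h2 : 0 ≤ ∑ x, p x * (1 + e x y) ^ (s / ρ) := Finset.sum_nonneg fun x _ =>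
    mul_nonneg (h.mem.1 x) (Real.rpow_nonneg (h.one_add_pos hθ x y).le _)
  rw [h1, h1, Real.mul_rpow (Real.rpow_nonneg (h.nonneg y) _) h2, ← Real.rpow_mul (h.nonneg y)]
  -- For ρ = 0 also s = 0, and both sides are 0.
  have h3 : s / ρ * ρ = s := by
    rcases eq_or_ne ρ 0 with h0 | h0
    · subst h0; simp; linarith
    · field_simp
  have h4 : q y ^ (1 - s) * q y ^ s = q y := by
    rw [← Real.rpow_add' (h.nonneg y) (by simp)]; simp
  rw [h3, mul_mul_mul_comm, h4]

/-- Jensen moves the logarithm inside the sum over outputs. The two factors then contribute s(1 - s)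
and ρu(1 - u) with u = s/ρ, which add up to s(2 - s - u) because ρu = s. -/
theorem Eo_le (h : IsCentered W p q e θ) (hθ : θ ≤ 1 / 12) {s ρ : ℝ} (hs : 0 ≤ s) (hsρ : s ≤ ρ)
    (hρ : ρ ≤ 1) : Eo W s ρ p ≤ (1 + 30 * θ) * (s * (2 - s - s / ρ)) * halfVar p q e := by
  have hθ0 := h.bound_nonneg
  have hρ0 : 0 ≤ ρ := hs.trans hsρ
  have hu0 : 0 ≤ s / ρ := div_nonneg hs hρ0
  have hu1 : s / ρ ≤ 1 := div_le_one_of_le₀ hsρ hρ0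
  have hρu : ρ * (s / ρ) = s := by
    rcases eq_or_ne ρ 0 with h0 | h0
    · subst h0; simp; linarith
    · field_simp
  rw [h.Eo_eq hθ hs hsρ]
  set u := s / ρ
  have hz : ∀ a y, 0 ≤ a → a ≤ 1 →
      0 ≤ a * (1 - a) * (1 + 4 * θ) * ((∑ x, p x * e x y ^ 2) / 2) ∧
      a * (1 - a) * (1 + 4 * θ) * ((∑ x, p x * e x y ^ 2) / 2) ≤ θ := fun a y ha ha1 => by
    have h0 : 0 ≤ a * (1 - a) := mul_nonneg ha (by linarith)
    have h1 : a * (1 - a) ≤ 1 := by nlinarith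
    have h2 := h.var_nonneg y
    have h3 := h.var_le y
    refine ⟨by positivity, ?_⟩
    calc _ ≤ 1 * (1 + 4 * θ) * (θ ^ 2 / 2) := by gcongr
      _ ≤ θ := by nlinarith [mul_nonneg hθ0 hθ0, mul_nonneg hθ0 (mul_nonneg hθ0 hθ0)]
  have hA : ∀ (a : ℝ) (y : Y), 0 ≤ a → a ≤ 1 → 0 < ∑ x, p x * (1 + e x y) ^ a := fun a y ha ha1 => by
    linarith [(h.sum_rpow_bounds hθ ha ha1 y).1, (hz a y ha ha1).2]
  have hL : ∀ a y, 0 ≤ a → a ≤ 1 → -Real.log (∑ x, p x * (1 + e x y) ^ a) ≤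
      (1 + 30 * θ) * (a * (1 - a)) * ((∑ x, p x * e x y ^ 2) / 2) := fun a y ha ha1 => by
    refine (neg_log_le_of_one_sub_le (by linarith) (hz a y ha ha1).1 (hz a y ha ha1).2
      (h.sum_rpow_bounds hθ ha ha1 y).1).trans ?_
    have h0 : 0 ≤ a * (1 - a) * ((∑ x, p x * e x y ^ 2) / 2) :=
      mul_nonneg (mul_nonneg ha (by linarith)) (h.var_nonneg y)
    have h1 : (1 + 4 * θ) * (1 + 2 * θ) ≤ 1 + 30 * θ := by nlinarith
    nlinarith [mul_le_mul_of_nonneg_left h1 h0]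
  have hJ := sum_mul_log_le h.nonneg h.sum_eq (z := fun y => (∑ x, p x * (1 + e x y) ^ (1 - s)) *
      (∑ x, p x * (1 + e x y) ^ u) ^ ρ) (fun y => mul_pos (hA _ y (by linarith) (by linarith))
        (Real.rpow_pos_of_pos (hA u y hu0 hu1) _))
  refine (neg_le_neg hJ).trans ?_
  rw [← Finset.sum_neg_distrib, halfVar, Finset.mul_sum]
  refine Finset.sum_le_sum fun y _ => ?_
  have hs1 : 0 ≤ 1 - s := by linarith
  rw [Real.log_mul (hA _ y hs1 (by linarith)).ne'
    (Real.rpow_pos_of_pos (hA u y hu0 hu1) _).ne', Real.log_rpow (hA u y hu0 hu1), ← mul_neg,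
    mul_left_comm]
  refine mul_le_mul_of_nonneg_left ?_ (h.nonneg y)
  have e1 := hL (1 - s) y hs1 (by linarith)
  have e2 := mul_le_mul_of_nonneg_left (hL u y hu0 hu1) hρ0
  calc _ = -Real.log (∑ x, p x * (1 + e x y) ^ (1 - s))
        + ρ * -Real.log (∑ x, p x * (1 + e x y) ^ u) := by ring
    _ ≤ _ := add_le_add e1 e2
    _ = (1 + 30 * θ) * (s * (1 - s) + ρ * u * (1 - u)) * ((∑ x, p x * e x y ^ 2) / 2) := by ring
    _ = _ := by rw [hρu]; ring

/-- In this direction log z ≤ z - 1 replaces Jensen, and Bernoulli's inequality b^ρ ≤ 1 + ρ(b - 1)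
handles the outer power. The cross term of (1 - A)(1 - B) is absorbed in a relative factor 1 - θ. -/
theorem le_Eo (h : IsCentered W p q e θ) (hθ : θ ≤ 1 / 12) {s ρ : ℝ} (hs : 0 ≤ s) (hsρ : s ≤ ρ)
    (hρ : ρ ≤ 1) : (1 - 30 * θ) * (s * (2 - s - s / ρ)) * halfVar p q e ≤ Eo W s ρ p := by
  have hθ0 := h.bound_nonneg
  have hρ0 : 0 ≤ ρ := hs.trans hsρ
  have hu0 : 0 ≤ s / ρ := div_nonneg hs hρ0
  have hu1 : s / ρ ≤ 1 := div_le_one_of_le₀ hsρ hρ0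
  have hρu : ρ * (s / ρ) = s := by
    rcases eq_or_ne ρ 0 with h0 | h0
    · subst h0; simp; linarith
    · field_simp
  rw [h.Eo_eq hθ hs hsρ]
  set u := s / ρ
  have hs1 : 0 ≤ 1 - s := by linarith
  have hX : ∃ x, p x ≠ 0 := by
    by_contra! h0
    have := h.mem.2
    simp [h0] at this
  have hA : ∀ (a : ℝ) (y : Y), 0 < ∑ x, p x * (1 + e x y) ^ a := fun a y => by
    obtain ⟨x, hx⟩ := hX
    exact Finset.sum_pos' (fun x _ => mul_nonneg (h.mem.1 x)
      (Real.rpow_nonneg (h.one_add_pos hθ x y).le _)) ⟨x, Finset.mem_univ _,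
      mul_pos ((h.mem.1 x).lt_of_ne' hx) (Real.rpow_pos_of_pos (h.one_add_pos hθ x y) _)⟩
  have hpos : 0 < ∑ y, q y * ((∑ x, p x * (1 + e x y) ^ (1 - s)) *
      (∑ x, p x * (1 + e x y) ^ u) ^ ρ) := by
    have hY : ∃ y, q y ≠ 0 := by
      by_contra! h0
      have := h.sum_eq
      simp [h0] at this
    obtain ⟨y, hy⟩ := hY
    have hp' : ∀ y, 0 < (∑ x, p x * (1 + e x y) ^ (1 - s)) * (∑ x, p x * (1 + e x y) ^ u) ^ ρ :=
      fun y => mul_pos (hA _ y) (Real.rpow_pos_of_pos (hA u y) _)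
    exact Finset.sum_pos' (fun y _ => mul_nonneg (h.nonneg y) (hp' y).le) ⟨y, Finset.mem_univ _,
      mul_pos ((h.nonneg y).lt_of_ne' hy) (hp' y)⟩
  have hlog := Real.log_le_sub_one_of_pos hpos
  suffices hsum : ∑ y, q y * ((∑ x, p x * (1 + e x y) ^ (1 - s)) *
      (∑ x, p x * (1 + e x y) ^ u) ^ ρ) ≤
      ∑ y, (q y - (1 - 30 * θ) * (s * (2 - s - u)) * (q y * ((∑ x, p x * e x y ^ 2) / 2))) by
    rw [Finset.sum_sub_distrib, h.sum_eq, ← Finset.mul_sum] at hsum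
    rw [halfVar]
    linarith
  refine Finset.sum_le_sum fun y _ => ?_
  rw [mul_left_comm _ (q y) (_ / 2), ← mul_one_sub]
  refine mul_le_mul_of_nonneg_left ?_ (h.nonneg y)
  have h1 := (h.sum_rpow_bounds hθ hs1 (by linarith) y).2
  have h2 := (h.sum_rpow_bounds hθ hu0 hu1 y).2
  have hV0 := h.var_nonneg y
  have hV1 := h.var_le y
  set V := (∑ x, p x * e x y ^ 2) / 2
  set a := ∑ x, p x * (1 + e x y) ^ (1 - s)
  set b := ∑ x, p x * (1 + e x y) ^ u with hb
  have hb0 : 0 < b := hA u y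
  have hbρ : b ^ ρ ≤ 1 + ρ * (b - 1) := by
    have := rpow_one_add_le_one_add_mul_self (s := b - 1) (by linarith) hρ0 hρ
    simpa using this
  have ha0 : 0 < a := hA (1 - s) y
  have hκ : 0 ≤ 1 - 4 * θ := by linarith
  set A := s * (1 - s) * (1 - 4 * θ) * V with hAdef
  set B := s * (1 - u) * (1 - 4 * θ) * V with hBdef
  have hss : s * (1 - s) ≤ 1 := by nlinarith
  have hA0 : 0 ≤ A := by
    have := mul_nonneg hs hs1
    positivity
  have hAθ : A ≤ θ := by
    calc A ≤ 1 * 1 * (θ ^ 2 / 2) := by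
          rw [hAdef]; gcongr; linarith
      _ ≤ θ := by nlinarith
  have hB0 : 0 ≤ B := by
    have : 0 ≤ 1 - u := by linarith
    positivity
  have h1' : a ≤ 1 - A := by linarith
  have h2' : b ^ ρ ≤ 1 - B := by
    have : ρ * (b - 1) ≤ ρ * (-(u * (1 - u) * (1 - 4 * θ) * V)) :=
      mul_le_mul_of_nonneg_left (by linarith) hρ0
    have e : ρ * (-(u * (1 - u) * (1 - 4 * θ) * V)) = -B := by
      rw [hBdef]; linear_combination -(1 - u) * (1 - 4 * θ) * V * hρu
    linarith
  have h3 : a * b ^ ρ ≤ (1 - A) * (1 - B) :=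
    mul_le_mul h1' h2' (Real.rpow_nonneg hb0.le _) (by linarith)
  have h4 : (1 - A) * (1 - B) ≤ 1 - (1 - θ) * (A + B) := by nlinarith
  have h5 : A + B = (1 - 4 * θ) * (s * (2 - s - u) * V) := by rw [hAdef, hBdef]; ring
  have h6 : 0 ≤ s * (2 - s - u) * V := mul_nonneg (mul_nonneg hs (by linarith)) hV0
  have h7 : (1 - 30 * θ) ≤ (1 - θ) * (1 - 4 * θ) := by nlinarith
  have h8 := mul_le_mul_of_nonneg_right h7 h6
  rw [h5] at h4
  linarith

/-- Jensen for the logarithm cancels the factor ρ against the power 1/ρ, so the bound does not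
depend on ρ. What is left is an average over pairs of inputs of a squared distance between their
deviations. -/
theorem Ex_le (h : IsCentered W p q e θ) (hθ : θ ≤ 1 / 12) {s ρ : ℝ} (hs : 0 ≤ s) (hs1 : s ≤ 1)
    (hρ : 1 ≤ ρ) : Ex W s ρ p ≤ (1 + 30 * θ) * (2 * s * (1 - s)) * halfVar p q e := by
  have hθ0 := h.bound_nonneg
  have hρ0 : 0 < ρ := by linarith
  have hss : 0 ≤ s * (1 - s) := mul_nonneg hs (by linarith)
  have hss1 : s * (1 - s) ≤ 1 / 4 := by nlinarith [sq_nonneg (s - 1 / 2)]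
  set D : X → X → ℝ := fun x x₁ => ∑ y, q y * (e x₁ y - e x y) ^ 2 with hD
  set H : X → X → ℝ := fun x x₁ => ∑ y, W x y ^ (1 - s) * W x₁ y ^ s with hH
  -- Expansion in the ratio 1 + d of the two likelihoods. Since |d| ≤ 3θ, the power costs 1 + 4 ·
  -- 3θ, and dividing by 1 + e costs 1 + 2θ.
  have hpt : ∀ x x₁ y, q y * ((1 + e x y) + s * (e x₁ y - e x y)
      - s * (1 - s) / 2 * ((1 + 12 * θ) * (1 + 2 * θ)) * (e x₁ y - e x y) ^ 2) ≤
      W x y ^ (1 - s) * W x₁ y ^ s := fun x x₁ y => by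
    have hx := h.one_add_pos hθ x y
    have hx₁ := h.one_add_pos hθ x₁ y
    have bx := abs_le.1 (h.bound x y)
    have bx₁ := abs_le.1 (h.bound x₁ y)
    set d := (e x₁ y - e x y) / (1 + e x y) with hd
    have hd1 : 1 + d = (1 + e x₁ y) / (1 + e x y) := by rw [hd]; field_simp; ring
    have hdabs : |d| ≤ 3 * θ := by
      rw [hd, abs_div, abs_of_pos hx, div_le_iff₀ hx, abs_le]
      constructor <;> nlinarith
    have e1 : W x y ^ (1 - s) * W x₁ y ^ s = q y * ((1 + e x y) * (1 + d) ^ s) := by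
      rw [h.eq, h.eq, Real.mul_rpow (h.nonneg y) hx.le, Real.mul_rpow (h.nonneg y) hx₁.le,
        mul_mul_mul_comm, ← Real.rpow_add' (h.nonneg y) (by simp), hd1,
        Real.div_rpow hx₁.le hx.le, Real.rpow_sub hx, Real.rpow_one, sub_add_cancel, Real.rpow_one]
      field_simp
    rw [e1]
    refine mul_le_mul_of_nonneg_left ?_ (h.nonneg y)
    have e2 := mul_le_mul_of_nonneg_left
      (one_add_rpow_bounds hs hs1 (by linarith) hdabs).1 hx.le
    refine le_trans ?_ e2
    have e3 : (1 + e x y) * d = e x₁ y - e x y := by rw [hd]; field_simp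
    have e4 : (1 + e x y) * d ^ 2 ≤ (1 + 2 * θ) * (e x₁ y - e x y) ^ 2 := by
      have : (1 + e x y) * d ^ 2 = (1 + e x y)⁻¹ * (e x₁ y - e x y) ^ 2 := by
        rw [hd]; field_simp
      rw [this]
      refine mul_le_mul_of_nonneg_right ?_ (sq_nonneg _)
      rw [← one_div, div_le_iff₀ hx]
      nlinarith
    have e5 : 0 ≤ s * (1 - s) / 2 * (1 + 12 * θ) := by positivity
    have e6 := mul_le_mul_of_nonneg_left e4 e5
    nlinarith
  have hDle : ∀ x x₁, D x x₁ ≤ 4 * θ ^ 2 := fun x x₁ => by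
    have : D x x₁ ≤ ∑ y, q y * (4 * θ ^ 2) := Finset.sum_le_sum fun y _ => by
      refine mul_le_mul_of_nonneg_left ?_ (h.nonneg y)
      have bx := abs_le.1 (h.bound x y)
      have bx₁ := abs_le.1 (h.bound x₁ y)
      nlinarith
    rwa [← Finset.sum_mul, h.sum_eq, one_mul] at this
  have hD0 : ∀ x x₁, 0 ≤ D x x₁ := fun x x₁ =>
    Finset.sum_nonneg fun y _ => mul_nonneg (h.nonneg y) (sq_nonneg _)
  have hHge : ∀ x x₁, 1 - s * (1 - s) / 2 * ((1 + 12 * θ) * (1 + 2 * θ)) * D x x₁ ≤ H x x₁ :=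
    fun x x₁ => by
      refine le_trans (le_of_eq ?_) (Finset.sum_le_sum fun y _ => hpt x x₁ y)
      have : ∀ y, q y * ((1 + e x y) + s * (e x₁ y - e x y)
        - s * (1 - s) / 2 * ((1 + 12 * θ) * (1 + 2 * θ)) * (e x₁ y - e x y) ^ 2)
        = q y + (1 - s) * (q y * e x y) + s * (q y * e x₁ y)
          - s * (1 - s) / 2 * ((1 + 12 * θ) * (1 + 2 * θ)) * (q y * (e x₁ y - e x y) ^ 2) :=
        fun y => by ring
      simp only [this, Finset.sum_add_distrib, Finset.sum_sub_distrib, ← Finset.mul_sum, h.sum_out,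
        h.sum_eq]
      simp [hD]
  have hz0 : ∀ x x₁, 0 ≤ s * (1 - s) / 2 * ((1 + 12 * θ) * (1 + 2 * θ)) * D x x₁ := fun x x₁ => by
    have := hD0 x x₁
    positivity
  have hzθ : ∀ x x₁, s * (1 - s) / 2 * ((1 + 12 * θ) * (1 + 2 * θ)) * D x x₁ ≤ θ := fun x x₁ => by
    have := hD0 x x₁
    calc _ ≤ (1 / 4) / 2 * (2 * 2) * (4 * θ ^ 2) := by
          gcongr
          · linarith
          · linarith
          · exact hDle x x₁
      _ ≤ θ := by nlinarith
  have hHpos : ∀ x x₁, 0 < H x x₁ := fun x x₁ => by linarith [hHge x x₁, hzθ x x₁]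
  have hlog : ∀ x x₁, -Real.log (H x x₁) ≤ (1 + 30 * θ) * (s * (1 - s) / 2) * D x x₁ :=
    fun x x₁ => by
      refine (neg_log_le_of_one_sub_le (by linarith) (hz0 x x₁) (hzθ x x₁) (hHge x x₁)).trans ?_
      have h0 : 0 ≤ s * (1 - s) / 2 * D x x₁ := mul_nonneg (by linarith) (hD0 x x₁)
      have h1 : (1 + 12 * θ) * (1 + 2 * θ) * (1 + 2 * θ) ≤ 1 + 30 * θ := by
        nlinarith [mul_nonneg hθ0 hθ0, mul_nonneg hθ0 (mul_nonneg hθ0 hθ0),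
          mul_nonneg (mul_nonneg hθ0 hθ0) (sub_nonneg.2 hθ)]
      nlinarith [mul_le_mul_of_nonneg_left h1 h0]
  have hJ := sum_mul_log_le (ι := X × X) (w := fun i => p i.1 * p i.2)
    (z := fun i => H i.1 i.2 ^ (1 / ρ)) (fun i => mul_nonneg (h.mem.1 _) (h.mem.1 _))
    (by rw [Fintype.sum_prod_type]; simp only [← Finset.mul_sum, h.mem.2, mul_one])
    (fun i => Real.rpow_pos_of_pos (hHpos _ _) _)
  simp only [Fintype.sum_prod_type] at hJ
  have hEx : Ex W s ρ p ≤ ∑ x, ∑ x₁, p x * p x₁ * -Real.log (H x x₁) := by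
    rw [Ex]
    have := mul_le_mul_of_nonneg_left hJ hρ0.le
    have e : ρ * ∑ x, ∑ x₁, p x * p x₁ * Real.log (H x x₁ ^ (1 / ρ))
        = ∑ x, ∑ x₁, p x * p x₁ * Real.log (H x x₁) := by
      simp only [Finset.mul_sum]
      refine Finset.sum_congr rfl fun x _ => Finset.sum_congr rfl fun x₁ _ => ?_
      rw [Real.log_rpow (hHpos x x₁)]
      field_simp
    rw [e] at this
    simp only [mul_neg, Finset.sum_neg_distrib, neg_mul]
    linarith
  refine hEx.trans ?_
  have h9 : ∑ x, ∑ x₁, p x * p x₁ * -Real.log (H x x₁) ≤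
      ∑ x, ∑ x₁, p x * p x₁ * ((1 + 30 * θ) * (s * (1 - s) / 2) * D x x₁) :=
    Finset.sum_le_sum fun x _ => Finset.sum_le_sum fun x₁ _ =>
      mul_le_mul_of_nonneg_left (hlog x x₁) (mul_nonneg (h.mem.1 _) (h.mem.1 _))
  refine h9.trans (le_of_eq ?_)
  -- For independent inputs with centred deviations the mean squared difference is twice the mean
  -- square, that is, four times half of it.
  have h10 : ∑ x, ∑ x₁, p x * p x₁ * D x x₁ = 4 * halfVar p q e := by
    simp only [hD, Finset.mul_sum, halfVar]
    calc _ = ∑ x, ∑ y, ∑ x₁, p x * p x₁ * (q y * (e x₁ y - e x y) ^ 2) :=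
          Finset.sum_congr rfl fun x _ => Finset.sum_comm
      _ = ∑ y, ∑ x, ∑ x₁, p x * p x₁ * (q y * (e x₁ y - e x y) ^ 2) := Finset.sum_comm
      _ = _ := Finset.sum_congr rfl fun y _ => ?_
    have e1 : ∀ x, ∑ x₁, p x * p x₁ * (q y * (e x₁ y - e x y) ^ 2)
        = q y * (∑ x₁, p x₁ * e x₁ y ^ 2) * p x + q y * (p x * e x y ^ 2) := fun x => by
      have : ∀ x₁, p x * p x₁ * (q y * (e x₁ y - e x y) ^ 2)
        = q y * p x * (p x₁ * e x₁ y ^ 2) - 2 * (q y * p x * e x y) * (p x₁ * e x₁ y)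
          + q y * (p x * e x y ^ 2) * p x₁ := fun x₁ => by ring
      simp only [this, Finset.sum_add_distrib, Finset.sum_sub_distrib, ← Finset.mul_sum, h.sum_in,
        h.mem.2]
      ring
    simp only [e1, Finset.sum_add_distrib, ← Finset.mul_sum, h.mem.2]
    ring
  have h11 : ∀ x x₁, p x * p x₁ * ((1 + 30 * θ) * (s * (1 - s) / 2) * D x x₁)
      = (1 + 30 * θ) * (s * (1 - s) / 2) * (p x * p x₁ * D x x₁) := fun x x₁ => by ring
  simp only [h11, ← Finset.mul_sum, h10]
  ring

end IsCentered

end Centered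

/-! ### The feedback exponent of a very noisy channel -/

section Feedback

variable {X : Type u} {Y : Type v} [Fintype X] [Fintype Y] {W : X → Y → ℝ}

/-- `capacity` is a real supremum, so boundedness of the set has to be supplied; the second order
bound gives 1 as an upper bound. -/
theorem IsVeryNoisy.mutualInfo_le_capacity {η : ℝ} (hη : η ≤ 1 / 48) (hW : IsVeryNoisy η W)
    {p : X → ℝ} (hp : p ∈ stdSimplex ℝ X) : mutualInfo W p ≤ capacity W := by
  refine le_csSup ⟨1, ?_⟩ ⟨p, hp, rfl⟩
  rintro _ ⟨p', hp', rfl⟩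
  obtain ⟨q, e, h⟩ := hW.exists_isCentered (by linarith) hp'
  have h1 := (h.mutualInfo_bounds (by linarith)).2
  have h2 := h.halfVar_le
  have h3 := h.halfVar_nonneg
  have h4 := h.bound_nonneg
  have h5 : (4 * η) ^ 2 ≤ 1 := by nlinarith
  nlinarith

/-- The first order behaviour of the exponent functions of a very noisy channel. -/
structure HasNoisyExponents (W : X → Y → ℝ) (p : X → ℝ) (δ : ℝ) : Prop where
  mem : p ∈ stdSimplex ℝ X
  capacity_nonneg : 0 ≤ capacity W
  Eo_le : ∀ p ∈ stdSimplex ℝ X, ∀ s ρ : ℝ, 0 ≤ s → s ≤ ρ → ρ ≤ 1 →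
    Eo W s ρ p ≤ (1 + δ) * (s * (2 - s - s / ρ)) * capacity W
  Ex_le : ∀ p ∈ stdSimplex ℝ X, ∀ s ρ : ℝ, 0 ≤ s → s ≤ 1 → 1 ≤ ρ →
    Ex W s ρ p ≤ (1 + δ) * (2 * s * (1 - s)) * capacity W
  le_Eo : ∀ s ρ : ℝ, 0 ≤ s → s ≤ ρ → ρ ≤ 1 →
    (1 - δ) * (s * (2 - s - s / ρ)) * capacity W ≤ Eo W s ρ p

/-- The upper bounds hold for every input law because its V is essentially at most its mutual
information, hence at most C. The lower bound needs V essentially at least C, which is where `p`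
must achieve capacity. -/
theorem IsVeryNoisy.hasNoisyExponents {δ η : ℝ} (hδ : 0 < δ) (hδ1 : δ ≤ 1) (hη : η = δ / 400)
    (hW : IsVeryNoisy η W) {p : X → ℝ} (hp : IsCapacityAchieving W p) :
    HasNoisyExponents W p δ := by
  have hηle : η ≤ 1 / 48 := by linarith
  have hS : ∀ p' ∈ stdSimplex ℝ X, ∃ q e, IsCentered W p' q e (4 * η) ∧
      (1 + 30 * (4 * η)) * halfVar p' q e ≤ (1 + δ) * capacity W := by
    intro p' hp'
    obtain ⟨q, e, h⟩ := hW.exists_isCentered (by linarith) hp'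
    refine ⟨q, e, h, ?_⟩
    have h1 := (h.mutualInfo_bounds (by linarith)).1
    have h2 := hW.mutualInfo_le_capacity hηle hp'
    have h3 := h.halfVar_nonneg
    -- The deviations are bounded by 4η; the relative errors 30 · 4η and 4 · 4η together fit into δ
    -- = 400η.
    have h4 : 1 + 30 * (4 * η) ≤ (1 + δ) * (1 - 4 * (4 * η)) := by subst hη; nlinarith
    have h5 := mul_le_mul_of_nonneg_right h4 h3
    have h6 := mul_le_mul_of_nonneg_left (h1.trans h2) (by linarith : 0 ≤ 1 + δ)
    linarith
  obtain ⟨q, e, h⟩ := hW.exists_isCentered (by linarith) hp.1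
  have h1 := h.mutualInfo_bounds (by linarith)
  rw [hp.2] at h1
  have h3 := h.halfVar_nonneg
  have hu : ∀ s ρ : ℝ, 0 ≤ s → s ≤ ρ → ρ ≤ 1 → 0 ≤ s * (2 - s - s / ρ) := fun s ρ hs hsρ hρ =>
    mul_nonneg hs (by linarith [div_le_one_of_le₀ hsρ (hs.trans hsρ)])
  refine ⟨hp.1, ?_, ?_, ?_, ?_⟩
  · exact le_trans (mul_nonneg (by linarith) h3) h1.1
  · intro p' hp' s ρ hs hsρ hρ
    obtain ⟨q', e', h', hS'⟩ := hS p' hp'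
    have := h'.Eo_le (by linarith) hs hsρ hρ
    nlinarith [mul_le_mul_of_nonneg_left hS' (hu s ρ hs hsρ hρ)]
  · intro p' hp' s ρ hs hs1 hρ
    obtain ⟨q', e', h', hS'⟩ := hS p' hp'
    have := h'.Ex_le (by linarith) hs hs1 hρ
    have h0 : 0 ≤ 2 * s * (1 - s) := mul_nonneg (by linarith) (by linarith)
    nlinarith [mul_le_mul_of_nonneg_left hS' h0]
  · intro s ρ hs hsρ hρ
    have := h.le_Eo (by linarith) hs hsρ hρ
    have h4 : (1 - δ) * (1 + 4 * (4 * η)) ≤ 1 - 30 * (4 * η) := by subst hη; nlinarith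
    have h5 := mul_le_mul_of_nonneg_right h4 h3
    have h6 := mul_le_mul_of_nonneg_left h1.2 (by linarith : 0 ≤ 1 - δ)
    have h7 : (1 - δ) * capacity W ≤ (1 - 30 * (4 * η)) * halfVar p q e := by linarith
    nlinarith [mul_le_mul_of_nonneg_left h7 (hu s ρ hs hsρ hρ)]

/-- Parameters for which the random coding expression is positive at a threshold slightly below
the feedback exponent. -/
theorem exists_exponent_parameters {C R δ : ℝ} (hC : 0 < C) (hR : 0 ≤ R) (hRC : R ≤ C)
    (hδ : 0 < δ) (hδ1 : δ ≤ 1) :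
    ∃ s ρ : ℝ, 0 < s ∧ s < 1 ∧ s ≤ ρ ∧ ρ ≤ 1 ∧
      ρ * R + s * (2 * C - 2 * (√C * √R) - δ * C) < (1 - δ / 8) * (s * (2 - s - s / ρ)) * C := by
  set a := √C with ha
  set b := √R with hb
  have ha2 : C = a * a := (Real.mul_self_sqrt hC.le).symm
  have hb2 : R = b * b := (Real.mul_self_sqrt hR).symm
  have ha0 : 0 < a := Real.sqrt_pos.2 hC
  have hb0 : 0 ≤ b := Real.sqrt_nonneg _
  have hba : b ≤ a := Real.sqrt_le_sqrt hRC
  -- w stands for s/ρ. Its ideal value is √R/√C; the maximum with δ/4 keeps it positive when R is 0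
  -- or very small.
  obtain ⟨w, hw0, hw1, hwb, hwa⟩ : ∃ w : ℝ, 0 < w ∧ w ≤ 1 ∧ b ≤ w * a ∧
      w * a ≤ b + δ / 4 * a := by
    refine ⟨max (b / a) (δ / 4), lt_max_of_lt_right (by linarith),
      max_le ((div_le_one ha0).2 hba) (by linarith), ?_, ?_⟩
    · exact (div_le_iff₀ ha0).1 (le_max_left _ _)
    · rw [max_mul_of_nonneg _ _ ha0.le, div_mul_cancel₀ _ ha0.ne']
      exact max_le (by nlinarith) (by linarith)
  have hρ0 : 0 < δ / 4 := by linarith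
  -- A small ρ makes s = wρ small, so the loss from the term -s in 2 - s - s/ρ is only wδ/4.
  refine ⟨w * (δ / 4), δ / 4, by positivity, by nlinarith, by nlinarith, by linarith, ?_⟩
  rw [mul_div_cancel_right₀ _ hρ0.ne', ha2, hb2]
  have key : b * b + w * (2 * (a * a) - 2 * (a * b) - δ * (a * a)) <
      (1 - δ / 8) * (w * (2 - w * (δ / 4) - w)) * (a * a) := by
    have e1 : b * b ≤ w * (a * b) := by nlinarith
    have e2 : w * (w * a * a) ≤ w * ((b + δ / 4 * a) * a) := by gcongr
    have e3 : 2 - w * (δ / 4) - w - δ / 4 ≤ (1 - δ / 8) * (2 - w * (δ / 4) - w) := by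
      nlinarith [mul_pos hw0 hδ, mul_pos hδ (mul_pos hw0 hδ)]
    have e4 := mul_le_mul_of_nonneg_left e3 (by positivity : 0 ≤ w * (a * a))
    have e5 : w * (a * a) * (w * (δ / 4)) ≤ w * (a * a) * (δ / 4) := by
      gcongr; nlinarith
    have e6 : 0 < w * (a * a) * δ := by positivity
    nlinarith
  have := mul_lt_mul_of_pos_left key hρ0
  calc _ = δ / 4 * (b * b + w * (2 * (a * a) - 2 * (a * b) - δ * (a * a))) := by ring
    _ < _ := this
    _ = _ := by ring

variable {p : X → ℝ} {δ : ℝ}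

/-- With w = s/ρ, the square ρ(√R - w√C)² ≥ 0 says 2s√(CR) ≤ ρR + swC, which disposes of the random
coding expression. The expurgated one uses the same square with ρ = 1, together with R ≤ ρR. The
margin δ ≥ 2δ₁ absorbs the relative error. -/
theorem HasNoisyExponents.E1_eq_zero {δ₁ : ℝ} (h : HasNoisyExponents W p δ₁) (hδ₁ : 0 ≤ δ₁)
    (hδ : 2 * δ₁ ≤ δ) {R : ℝ} (hR : 0 ≤ R) :
    E1 W R (2 * capacity W - 2 * (√(capacity W) * √R) + δ * capacity W) = 0 := by
  have hC := h.capacity_nonneg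
  set C := capacity W with hCdef
  have ha2 : C = √C * √C := (Real.mul_self_sqrt hC).symm
  have hb2 : R = √R * √R := (Real.mul_self_sqrt hR).symm
  have hab : 0 ≤ √C * √R := by positivity
  apply le_antisymm
  · refine sup_le (sSup_le ?_) (sSup_le ?_)
    · rintro _ ⟨s, ρ, p', hs, hsρ, hρ, hp', rfl⟩
      have h1 := h.Eo_le p' hp' s ρ hs hsρ hρ
      rw [← hCdef] at h1
      have hρ0 : 0 ≤ ρ := hs.trans hsρ
      have hu0 : 0 ≤ s / ρ := div_nonneg hs hρ0
      have hρu : ρ * (s / ρ) = s := by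
        rcases eq_or_ne ρ 0 with h0 | h0
        · subst h0; simp; linarith
        · field_simp
      set w := s / ρ
      have e1 : 0 ≤ ρ * (√R - w * √C) ^ 2 := by positivity
      have e2 : ρ * (√R - w * √C) ^ 2 = ρ * R - 2 * s * (√C * √R) + s * w * C := by
        rw [← hρu]
        linear_combination (-ρ) * hb2 - ρ * w ^ 2 * ha2
      have hsC := mul_nonneg hs hC
      have e3 : 0 ≤ s * C * (δ - δ₁ * 2) := mul_nonneg hsC (by linarith)
      have e4 : 0 ≤ s * C * s * (1 + δ₁) := by positivity
      have e5 : 0 ≤ s * C * w * δ₁ := by positivity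
      have : Eo W s ρ p' - ρ * R
          - s * (2 * C - 2 * (√C * √R) + δ * C) ≤ 0 := by nlinarith
      exact_mod_cast this
    · rintro _ ⟨s, ρ, p', hs, hs1, hρ, hp', rfl⟩
      have h1 := h.Ex_le p' hp' s ρ hs hs1 hρ
      rw [← hCdef] at h1
      have hsC := mul_nonneg hs hC
      have e3 : 0 ≤ s * C * (δ - δ₁ * 2) := mul_nonneg hsC (by linarith)
      have e4 : 0 ≤ s * C * s * δ₁ := by positivity
      have e5 : 0 ≤ (√R - s * √C) ^ 2 := sq_nonneg _
      have e6 : (√R - s * √C) ^ 2 = R - 2 * s * (√C * √R) + s * s * C := by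
        linear_combination (-1) * hb2 - s ^ 2 * ha2
      have e7 : 0 ≤ s * C * s := by positivity
      have e8 : R ≤ ρ * R := by nlinarith
      have : Ex W s ρ p' - ρ * R
          - s * (2 * C - 2 * (√C * √R) + δ * C) ≤ 0 := by nlinarith
      exact_mod_cast this
  -- At s = ρ = 0 the upper and the lower bound on `Eo` both vanish, so the value 0 is attained.
  · refine le_sup_of_le_left (le_sSup ⟨0, 0, p, le_rfl, le_rfl, zero_le_one, h.mem, ?_⟩)
    have h1 := h.Eo_le p h.mem 0 0 le_rfl le_rfl zero_le_one
    have h2 := h.le_Eo 0 0 le_rfl le_rfl zero_le_one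
    have : Eo W 0 0 p = 0 := le_antisymm (by simpa using h1) (by simpa using h2)
    simp [this]

theorem HasNoisyExponents.feedbackExponent_le {δ₁ : ℝ} (h : HasNoisyExponents W p δ₁)
    (hδ₁ : 0 ≤ δ₁) (hδ : 2 * δ₁ ≤ δ) {R : ℝ} (hR : 0 ≤ R) (hRC : R ≤ capacity W) :
    feedbackExponent W R ≤
      ((2 * capacity W - 2 * (√(capacity W) * √R) + δ * capacity W : ℝ) : EReal) := by
  refine sInf_le ⟨_, ?_, h.E1_eq_zero hδ₁ hδ hR, rfl⟩
  have hC := h.capacity_nonneg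
  have h1 : √(capacity W) * √R ≤ √(capacity W) * √(capacity W) := by gcongr
  rw [Real.mul_self_sqrt hC] at h1
  have : 0 ≤ δ * capacity W := mul_nonneg (by linarith) hC
  linarith

theorem HasNoisyExponents.le_feedbackExponent (h : HasNoisyExponents W p (δ / 8)) (hδ : 0 < δ)
    (hδ1 : δ ≤ 1) {R : ℝ} (hR : 0 ≤ R) (hRC : R ≤ capacity W) :
    ((2 * capacity W - 2 * (√(capacity W) * √R) - δ * capacity W : ℝ) : EReal) ≤
      feedbackExponent W R := by
  refine le_sInf ?_
  rintro _ ⟨T, hT, hE, rfl⟩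
  rw [EReal.coe_le_coe_iff]
  rcases h.capacity_nonneg.eq_or_lt with hC | hC
  -- At zero capacity the lower bound is 0, and T ≥ 0 is enough.
  · simpa [← hC] using hT
  · obtain ⟨s, ρ, hs, hs1, hsρ, hρ, hlt⟩ := exists_exponent_parameters hC hR hRC hδ hδ1
    have h1 := h.le_Eo s ρ hs.le hsρ hρ
    have h2 : ((Eo W s ρ p - ρ * R - s * T : ℝ) : EReal) ≤ 0 := by
      rw [← hE]
      exact le_sup_of_le_left (le_sSup ⟨s, ρ, p, hs.le, hsρ, hρ, h.mem, rfl⟩)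
    have h3 : Eo W s ρ p - ρ * R - s * T ≤ 0 := by exact_mod_cast h2
    have h4 : s * (2 * capacity W - 2 * (√(capacity W) * √R) - δ * capacity W) < s * T := by
      linarith
    exact (lt_of_mul_lt_mul_left h4 hs.le).le

end Feedback

/-! ### Averages over a random code -/

theorem sum_pi_prod {ι A : Type*} [Fintype ι] [DecidableEq ι] [Fintype A] (f : ι → A → ℝ) :
    ∑ a : ι → A, ∏ i, f i (a i) = ∏ i, ∑ x, f i x := by
  rw [Finset.prod_univ_sum, Fintype.piFinset_univ]

theorem sum_pi_pi_prod {A : Type*} [Fintype A] {L N : ℕ} (f : Fin L → Fin N → A → ℝ) :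
    ∑ a : Fin L → Fin N → A, ∏ r, ∏ i, f r i (a r i) = ∏ r, ∏ i, ∑ x, f r i x := by
  rw [sum_pi_prod (fun r (b : Fin N → A) => ∏ i, f r i (b i))]
  exact Finset.prod_congr rfl fun r _ => sum_pi_prod _

/-- For i.i.d. `c i`, the mean of `f (c m) (∑_{i ≠ m} g (c i))^ρ` is at most
`E f (M E g)^ρ` when `0 ≤ ρ ≤ 1`. -/
theorem sum_iid_mul_rpow_le {A : Type*} [Fintype A] {P f g : A → ℝ} (hP : ∀ a, 0 ≤ P a)
    (hP1 : ∑ a, P a = 1) (hf : ∀ a, 0 ≤ f a) (hg : ∀ a, 0 ≤ g a) {ρ : ℝ} (hρ : 0 ≤ ρ)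
    (hρ1 : ρ ≤ 1) {M : ℕ} (m : Fin M) :
    ∑ c : Fin M → A, (∏ i, P (c i)) * (f (c m) * (∑ i ∈ Finset.univ.erase m, g (c i)) ^ ρ) ≤
      (∑ a, P a * f a) * (M * ∑ a, P a * g a) ^ ρ := by
  obtain ⟨n, rfl⟩ : ∃ n, M = n + 1 := ⟨M - 1, by have := m.pos; omega⟩
  have hEg : 0 ≤ ∑ a, P a * g a := Finset.sum_nonneg fun a _ => mul_nonneg (hP a) (hg a)
  have hsum : ∀ c : Fin (n + 1) → A, ∑ i ∈ Finset.univ.erase m, g (c i)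
      = ∑ j, g (c (m.succAbove j)) := fun c => by
    rw [Finset.sum_erase_eq_sub (Finset.mem_univ m), Fin.sum_univ_succAbove _ m]; ring
  have hP' : ∀ c : Fin n → A, 0 ≤ ∏ j, P (c j) := fun c => Finset.prod_nonneg fun j _ => hP _
  have hmean : ∑ c : Fin n → A, (∏ j, P (c j)) * ∑ j, g (c j) = n * ∑ a, P a * g a := by
    simp only [Finset.mul_sum]
    rw [Finset.sum_comm]
    have : ∀ j₀ : Fin n, ∑ c : Fin n → A, (∏ j, P (c j)) * g (c j₀) = ∑ a, P a * g a := by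
      intro j₀
      have e : ∀ c : Fin n → A, (∏ j, P (c j)) * g (c j₀)
          = ∏ j, (P (c j) * if j = j₀ then g (c j) else 1) := fun c => by
        rw [Finset.prod_mul_distrib, Finset.prod_ite_eq' Finset.univ j₀ (fun j => g (c j)),
          if_pos (Finset.mem_univ _)]
      simp only [e]
      rw [sum_pi_prod (fun j a => P a * if j = j₀ then g a else 1)]
      rw [Finset.prod_eq_single j₀]
      · simp
      · intro j _ hj; simp [hj, hP1]
      · simp
    simp only [this, ← Finset.mul_sum]
    simp
  -- Jensen for the concave function z^ρ.
  have hJ : ∑ c : Fin n → A, (∏ j, P (c j)) * (∑ j, g (c j)) ^ ρ ≤ (n * ∑ a, P a * g a) ^ ρ := by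
    have := (Real.concaveOn_rpow hρ hρ1).le_map_sum (t := Finset.univ)
      (w := fun c : Fin n → A => ∏ j, P (c j)) (p := fun c => ∑ j, g (c j)) (fun c _ => hP' c)
      (by rw [sum_pi_prod (fun _ a => P a)]; simp [hP1])
      (fun c _ => Finset.sum_nonneg fun j _ => hg _)
    simpa only [smul_eq_mul, hmean] using this
  -- The codeword m is split off; it is independent of the n others.
  calc _ = ∑ a, ∑ c : Fin n → A,
        (P a * f a) * ((∏ j, P (c j)) * (∑ j, g (c j)) ^ ρ) := by
        rw [← (Fin.insertNthEquiv (fun _ => A) m).sum_comp, Fintype.sum_prod_type]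
        refine Finset.sum_congr rfl fun a _ => Finset.sum_congr rfl fun c _ => ?_
        rw [hsum, Fin.prod_univ_succAbove _ m]
        simp only [Fin.insertNthEquiv_apply, Fin.insertNth_apply_same,
          Fin.insertNth_apply_succAbove]
        ring
    _ = (∑ a, P a * f a) * ∑ c : Fin n → A, (∏ j, P (c j)) * (∑ j, g (c j)) ^ ρ := by
        simp only [← Finset.mul_sum, ← Finset.sum_mul]
    _ ≤ (∑ a, P a * f a) * (n * ∑ a, P a * g a) ^ ρ :=
        mul_le_mul_of_nonneg_left hJ (Finset.sum_nonneg fun a _ => mul_nonneg (hP a) (hf a))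
    _ ≤ _ := by
        refine mul_le_mul_of_nonneg_left (Real.rpow_le_rpow (by positivity) ?_ hρ)
          (Finset.sum_nonneg fun a _ => mul_nonneg (hP a) (hf a))
        exact mul_le_mul_of_nonneg_right (by push_cast; linarith) hEg

/-- Subadditivity of z^u. With u = s/ρ it moves the power inside the sum over the rival codewords,
leaving an outer power ρ ≤ 1 for Jensen. -/
theorem sum_rpow_le_sum_rpow {ι : Type*} (s : Finset ι) {f : ι → ℝ} (hf : ∀ i, 0 ≤ f i) {u : ℝ}
    (hu : 0 < u) (hu1 : u ≤ 1) : (∑ i ∈ s, f i) ^ u ≤ ∑ i ∈ s, f i ^ u := by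
  classical
  induction s using Finset.induction_on with
  | empty => simp [Real.zero_rpow hu.ne']
  | insert a s ha ih =>
    rw [Finset.sum_insert ha, Finset.sum_insert ha]
    exact (Real.rpow_add_le_add_rpow (hf a) (Finset.sum_nonneg fun i _ => hf i) hu.le hu1).trans
      (by gcongr)

/-! ### Likelihoods, decoders and random coding bounds. -/

section Coding

variable {X : Type u} {Y : Type v} {W : X → Y → ℝ} {p : X → ℝ} {M L N : ℕ}

theorem likelihood_nonneg (h0 : ∀ x y, 0 ≤ W x y) (k : ℕ) (x : Fin L → Fin N → X)
    (y : Fin L → Fin N → Y) : 0 ≤ likelihood W k x y :=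
  Finset.prod_nonneg fun _ _ => Finset.prod_nonneg fun _ _ => h0 _ _

theorem likelihood_eq_prod (k : ℕ) (x : Fin L → Fin N → X) (y : Fin L → Fin N → Y) :
    likelihood W k x y = ∏ r, ∏ i, if r.val < k then W (x r i) (y r i) else 1 := by
  rw [likelihood, Finset.prod_filter]
  refine Finset.prod_congr rfl fun r _ => ?_
  split_ifs <;> simp

theorem likelihood_full (x : Fin L → Fin N → X) (y : Fin L → Fin N → Y) :
    likelihood W L x y = ∏ r, ∏ i, W (x r i) (y r i) := by
  simp [likelihood_eq_prod]

theorem likelihood_one {n : ℕ} (x : Fin (n + 1) → Fin N → X) (y : Fin (n + 1) → Fin N → Y) :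
    likelihood W 1 x y = ∏ i, W (x 0 i) (y 0 i) := by
  rw [likelihood_eq_prod, Fin.prod_univ_succ]
  simp

/-- The decoder sees the outputs only through the likelihoods, and equal region predicates give the
same arbitrary choice among ties. This lets outputs of later rounds be ignored. -/
theorem erasureDecode_congr {k : ℕ} {t : ℝ} {c : Fin M → Fin L → Fin N → X}
    {y y' : Fin L → Fin N → Y} (h : ∀ m, likelihood W k (c m) y = likelihood W k (c m) y') :
    erasureDecode W k t c y = erasureDecode W k t c y' := by
  have : InRegion W k t c y = InRegion W k t c y' := by
    funext m
    simp only [InRegion, h]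
  unfold erasureDecode
  rw [this]

theorem inRegion_of_erasureDecode {k : ℕ} {t : ℝ} {c : Fin M → Fin L → Fin N → X}
    {y : Fin L → Fin N → Y} {m : Fin M} (h : erasureDecode W k t c y = some m) :
    InRegion W k t c y m := by
  unfold erasureDecode at h
  split_ifs at h with hex
  rw [← Option.some.inj h]
  exact hex.choose_spec

theorem likelihood_rpow (h0 : ∀ x y, 0 ≤ W x y) (k : ℕ) (x : Fin L → Fin N → X)
    (y : Fin L → Fin N → Y) (a : ℝ) :
    likelihood W k x y ^ a = ∏ r, ∏ i, if r.val < k then W (x r i) (y r i) ^ a else 1 := by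
  have h : ∀ r : Fin L, ∀ i, 0 ≤ if r.val < k then W (x r i) (y r i) else 1 := fun r i => by
    split_ifs
    exacts [h0 _ _, zero_le_one]
  rw [likelihood_eq_prod, ← Real.finsetProd_rpow _ _
    fun r _ => Finset.prod_nonneg fun i _ => h r i]
  refine Finset.prod_congr rfl fun r _ => ?_
  rw [← Real.finsetProd_rpow _ _ fun i _ => h r i]
  refine Finset.prod_congr rfl fun i _ => ?_
  split_ifs <;> simp

theorem sum_likelihood [Fintype Y] (h1 : ∀ x, ∑ y, W x y = 1) (x : Fin L → Fin N → X) :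
    ∑ y, likelihood W L x y = 1 := by
  simp only [likelihood_full]
  rw [sum_pi_pi_prod (fun r i y => W (x r i) y)]
  simp [h1]

variable [Fintype X]

theorem sum_codeword_prob (hp : p ∈ stdSimplex ℝ X) :
    ∑ a : Fin L → Fin N → X, ∏ r, ∏ i, p (a r i) = 1 := by
  rw [sum_pi_pi_prod (fun _ _ x => p x)]
  simp [hp.2]

theorem sum_code_prob (hp : p ∈ stdSimplex ℝ X) :
    ∑ c : Fin M → Fin L → Fin N → X, ∏ m, ∏ r, ∏ i, p (c m r i) = 1 := by
  rw [sum_pi_prod (fun _ (a : Fin L → Fin N → X) => ∏ r, ∏ i, p (a r i))]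
  simp [sum_codeword_prob hp]

theorem code_prob_nonneg (hp : p ∈ stdSimplex ℝ X) (c : Fin M → Fin L → Fin N → X) :
    0 ≤ ∏ m, ∏ r, ∏ i, p (c m r i) :=
  Finset.prod_nonneg fun _ _ => Finset.prod_nonneg fun _ _ => Finset.prod_nonneg fun _ _ => hp.1 _

variable [Fintype Y]

/-- Comparison is needed only where the transmitted codeword has positive likelihood; elsewhere the
weight is 0. Negative powers of the likelihood and the inactive thresholds are controlled only
there. -/
theorem mean_mono (h0 : ∀ x y, 0 ≤ W x y) (hp : p ∈ stdSimplex ℝ X)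
    {f g : (Fin M → Fin L → Fin N → X) → Fin M → (Fin L → Fin N → Y) → ℝ}
    (hfg : ∀ c m y, 0 < likelihood W L (c m) y → f c m y ≤ g c m y) :
    mean W p f ≤ mean W p g := by
  refine Finset.sum_le_sum fun c _ => mul_le_mul_of_nonneg_left ?_ (code_prob_nonneg hp c)
  refine mul_le_mul_of_nonneg_left ?_ (by positivity)
  refine Finset.sum_le_sum fun m _ => Finset.sum_le_sum fun y _ => ?_
  rcases (likelihood_nonneg h0 L (c m) y).eq_or_lt with h | h
  · simp [← h]
  · exact mul_le_mul_of_nonneg_left (hfg c m y h) h.le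

theorem mean_const (h1 : ∀ x, ∑ y, W x y = 1) (hp : p ∈ stdSimplex ℝ X) (hM : 0 < M) (a : ℝ) :
    mean W p (M := M) (L := L) (N := N) (fun _ _ _ => a) = a := by
  have : (M : ℝ) ≠ 0 := by positivity
  simp only [mean, ← Finset.sum_mul, sum_likelihood h1, sum_code_prob hp]
  simp [this]

theorem mean_add (f g : (Fin M → Fin L → Fin N → X) → Fin M → (Fin L → Fin N → Y) → ℝ) :
    mean W p (fun c m y => f c m y + g c m y) = mean W p f + mean W p g := by
  simp only [mean, mul_add, Finset.sum_add_distrib]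

theorem mean_const_mul (a : ℝ)
    (f : (Fin M → Fin L → Fin N → X) → Fin M → (Fin L → Fin N → Y) → ℝ) :
    mean W p (fun c m y => a * f c m y) = a * mean W p f := by
  simp only [mean, Finset.mul_sum]
  refine Finset.sum_congr rfl fun c _ => Finset.sum_congr rfl fun m _ =>
    Finset.sum_congr rfl fun y _ => by ring

theorem mean_mul_rpow_le (h0 : ∀ x y, 0 ≤ W x y) (hp : p ∈ stdSimplex ℝ X) (hM : 0 < M)
    {f g : (Fin L → Fin N → Y) → (Fin L → Fin N → X) → ℝ} (hf : ∀ y a, 0 ≤ f y a)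
    (hg : ∀ y a, 0 ≤ g y a) {ρ : ℝ} (hρ : 0 ≤ ρ) (hρ1 : ρ ≤ 1) :
    mean W p (M := M) (fun c m y => f y (c m) * (∑ i ∈ Finset.univ.erase m, g y (c i)) ^ ρ) ≤
      M ^ ρ * ∑ y, (∑ a, (∏ r, ∏ i, p (a r i)) * (likelihood W L a y * f y a)) *
        (∑ a, (∏ r, ∏ i, p (a r i)) * g y a) ^ ρ := by
  have hM' : (M : ℝ) ≠ 0 := by positivity
  set P : (Fin L → Fin N → X) → ℝ := fun a => ∏ r, ∏ i, p (a r i) with hP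
  have hP0 : ∀ a, 0 ≤ P a := fun a =>
    Finset.prod_nonneg fun _ _ => Finset.prod_nonneg fun _ _ => hp.1 _
  have hEg : ∀ y, 0 ≤ ∑ a, P a * g y a := fun y =>
    Finset.sum_nonneg fun a _ => mul_nonneg (hP0 a) (hg y a)
  calc _ = (1 / (M : ℝ)) * ∑ m : Fin M, ∑ y, ∑ c : Fin M → Fin L → Fin N → X, (∏ i, P (c i)) *
        ((likelihood W L (c m) y * f y (c m)) *
          (∑ i ∈ Finset.univ.erase m, g y (c i)) ^ ρ) := by
        simp only [mean, Finset.mul_sum]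
        rw [Finset.sum_comm]
        refine Finset.sum_congr rfl fun m _ => ?_
        rw [Finset.sum_comm]
        refine Finset.sum_congr rfl fun y _ => Finset.sum_congr rfl fun c _ => ?_
        simp only [hP]; ring
    _ ≤ (1 / (M : ℝ)) * ∑ m : Fin M, ∑ y, (∑ a, P a * (likelihood W L a y * f y a)) *
        (M * ∑ a, P a * g y a) ^ ρ := by
        refine mul_le_mul_of_nonneg_left ?_ (by positivity)
        refine Finset.sum_le_sum fun m _ => Finset.sum_le_sum fun y _ => ?_
        exact sum_iid_mul_rpow_le hP0 (sum_codeword_prob hp)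
          (f := fun a => likelihood W L a y * f y a)
          (fun a => mul_nonneg (likelihood_nonneg h0 _ _ _) (hf y a)) (hg y) hρ hρ1 m
    _ = _ := by
        rw [Finset.sum_const, Finset.card_univ, Fintype.card_fin, nsmul_eq_mul, ← mul_assoc,
          one_div, inv_mul_cancel₀ hM', one_mul, Finset.mul_sum]
        refine Finset.sum_congr rfl fun y _ => ?_
        rw [Real.mul_rpow (by positivity) (hEg y)]
        ring

/-- Random coding bound for the event that the likelihood of the transmitted codeword does not
exceed `e^{kNt}` times the sum of the others after `k` rounds. -/
theorem mean_indicator_le (h0 : ∀ x y, 0 ≤ W x y) (h1 : ∀ x, ∑ y, W x y = 1)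
    (hp : p ∈ stdSimplex ℝ X) (hM : 0 < M) {k : ℕ} (hk : k ≤ L) {s ρ : ℝ} (hs : 0 < s)
    (hs1 : s < 1) (hsρ : s ≤ ρ) (hρ : ρ ≤ 1) (t : ℝ) :
    mean W p (M := M) (L := L) (N := N) (fun c m y =>
      open Classical in if likelihood W k (c m) y ≤
        Real.exp (k * N * t) * ∑ i ∈ Finset.univ.erase m, likelihood W k (c i) y then 1 else 0) ≤
      Real.exp (s * (k * N * t)) * M ^ ρ * Real.exp (-(k * N * Eo W s ρ p)) := by
  classical
  have hρ0 : 0 < ρ := hs.trans_le hsρ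
  have hu0 : 0 < s / ρ := div_pos hs hρ0
  have hu1 : s / ρ ≤ 1 := (div_le_one hρ0).2 hsρ
  have hl0 := fun (x : Fin L → Fin N → X) (y : Fin L → Fin N → Y) => likelihood_nonneg h0 k x y
  set G := ∑ y, (∑ x, p x * W x y ^ (1 - s)) * (∑ x, p x * W x y ^ (s / ρ)) ^ ρ with hG
  have hG0 : 0 ≤ G := Finset.sum_nonneg fun y _ => mul_nonneg
    (Finset.sum_nonneg fun x _ => mul_nonneg (hp.1 x) (Real.rpow_nonneg (h0 x y) _))
    (Real.rpow_nonneg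
      (Finset.sum_nonneg fun x _ => mul_nonneg (hp.1 x) (Real.rpow_nonneg (h0 x y) _)) _)
  have hGexp : G ^ (k * N) ≤ Real.exp (-(k * N * Eo W s ρ p)) := by
    -- Valid for every real G, including G = 0, where the logarithm takes its default value 0.
    have : G ≤ Real.exp (-Eo W s ρ p) := by
      rw [Eo, neg_neg]; exact Real.le_exp_log G
    calc G ^ (k * N) ≤ Real.exp (-Eo W s ρ p) ^ (k * N) := pow_le_pow_left₀ hG0 this _
      _ = _ := by rw [← Real.exp_nat_mul]; congr 1; push_cast; ring
  -- Chernoff step: the indicator is at most the s-th power of the ratio of the two sides of the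
  -- event.
  have hstep : mean W p (M := M) (L := L) (N := N) (fun c m y =>
      if likelihood W k (c m) y ≤
        Real.exp (k * N * t) * ∑ i ∈ Finset.univ.erase m, likelihood W k (c i) y then 1 else 0) ≤
      mean W p (M := M) (L := L) (N := N) (fun c m y => Real.exp (s * (k * N * t)) *
        (likelihood W k (c m) y ^ (-s) *
          (∑ i ∈ Finset.univ.erase m, likelihood W k (c i) y ^ (s / ρ)) ^ ρ)) := by
    refine mean_mono h0 hp fun c m y hpos => ?_
    set l := likelihood W k (c m) y with hl
    set S := ∑ i ∈ Finset.univ.erase m, likelihood W k (c i) y with hS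
    have hS0 : 0 ≤ S := Finset.sum_nonneg fun i _ => hl0 _ _
    -- A zero factor in the first k rounds would make the full likelihood zero.
    have hlpos : 0 < l := by
      refine (hl0 _ _).lt_of_ne fun h => hpos.ne ?_
      rw [likelihood_full]
      rw [likelihood, eq_comm, Finset.prod_eq_zero_iff] at h
      obtain ⟨r, -, hr⟩ := h
      exact (Finset.prod_eq_zero (Finset.mem_univ r) hr).symm
    have hnn : 0 ≤ Real.exp (s * (k * N * t)) * (l ^ (-s) *
        (∑ i ∈ Finset.univ.erase m, likelihood W k (c i) y ^ (s / ρ)) ^ ρ) :=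
      mul_nonneg (Real.exp_pos _).le (mul_nonneg (Real.rpow_nonneg hlpos.le _)
        (Real.rpow_nonneg (Finset.sum_nonneg fun i _ => Real.rpow_nonneg (hl0 _ _) _) _))
    split_ifs with hle
    · have e1 : l ^ s ≤ Real.exp (s * (k * N * t)) * S ^ s := by
        calc l ^ s ≤ (Real.exp (k * N * t) * S) ^ s := Real.rpow_le_rpow hlpos.le hle hs.le
          _ = _ := by
            rw [Real.mul_rpow (Real.exp_pos _).le hS0, ← Real.exp_mul, mul_comm s]
      have e2 : S ^ s ≤ (∑ i ∈ Finset.univ.erase m, likelihood W k (c i) y ^ (s / ρ)) ^ ρ := by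
        calc S ^ s = (S ^ (s / ρ)) ^ ρ := by
              rw [← Real.rpow_mul hS0, div_mul_cancel₀ _ hρ0.ne']
          _ ≤ _ := Real.rpow_le_rpow (Real.rpow_nonneg hS0 _)
              (sum_rpow_le_sum_rpow _ (fun i => hl0 _ _) hu0 hu1) hρ0.le
      have e3 : l ^ (-s) * l ^ s = 1 := by rw [← Real.rpow_add hlpos]; simp
      have hls : 0 ≤ l ^ (-s) := Real.rpow_nonneg hlpos.le _
      calc (1 : ℝ) = l ^ (-s) * l ^ s := e3.symm
        _ ≤ l ^ (-s) * (Real.exp (s * (k * N * t)) *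
            (∑ i ∈ Finset.univ.erase m, likelihood W k (c i) y ^ (s / ρ)) ^ ρ) := by
          refine mul_le_mul_of_nonneg_left (e1.trans ?_) hls
          exact mul_le_mul_of_nonneg_left e2 (Real.exp_pos _).le
        _ = _ := by ring
    · exact hnn
  refine hstep.trans ?_
  rw [mean_const_mul, mul_assoc (Real.exp _)]
  refine mul_le_mul_of_nonneg_left ?_ (Real.exp_pos _).le
  refine (mean_mul_rpow_le h0 hp hM (f := fun y a => likelihood W k a y ^ (-s))
    (g := fun y a => likelihood W k a y ^ (s / ρ)) (fun y a => Real.rpow_nonneg (hl0 _ _) _)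
    (fun y a => Real.rpow_nonneg (hl0 _ _) _) hρ0.le hρ).trans ?_
  refine mul_le_mul_of_nonneg_left (le_trans (le_of_eq ?_) hGexp) (by positivity)
  have hA : ∀ y : Fin L → Fin N → Y, ∑ a : Fin L → Fin N → X,
      (∏ r, ∏ i, p (a r i)) * (likelihood W L a y * likelihood W k a y ^ (-s)) =
      ∏ r, ∏ i, ∑ x, p x * if r.val < k then W x (y r i) ^ (1 - s) else W x (y r i) := fun y => by
    rw [← sum_pi_pi_prod
      (fun r i x => p x * if r.val < k then W x (y r i) ^ (1 - s) else W x (y r i))]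
    refine Finset.sum_congr rfl fun a _ => ?_
    rw [likelihood_full, likelihood_rpow h0]
    simp only [← Finset.prod_mul_distrib]
    refine Finset.prod_congr rfl fun r _ => Finset.prod_congr rfl fun i _ => ?_
    split_ifs
    · rcases (h0 (a r i) (y r i)).eq_or_lt with h | h
      · rw [← h, Real.zero_rpow (by linarith : 1 - s ≠ 0)]; simp
      · rw [sub_eq_add_neg, Real.rpow_add h, Real.rpow_one]
    · simp
  have hB : ∀ y : Fin L → Fin N → Y, ∑ a : Fin L → Fin N → X,
      (∏ r, ∏ i, p (a r i)) * likelihood W k a y ^ (s / ρ) =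
      ∏ r, ∏ i, ∑ x, p x * if r.val < k then W x (y r i) ^ (s / ρ) else 1 := fun y => by
    rw [← sum_pi_pi_prod (fun r i x => p x * if r.val < k then W x (y r i) ^ (s / ρ) else 1)]
    refine Finset.sum_congr rfl fun a _ => ?_
    rw [likelihood_rpow h0]
    simp only [← Finset.prod_mul_distrib]
  have hB0 : ∀ (r : Fin L) (y : Y),
      0 ≤ ∑ x, p x * if r.val < k then W x y ^ (s / ρ) else 1 := fun r y =>
    Finset.sum_nonneg fun x _ => mul_nonneg (hp.1 x) (by
      split_ifs
      exacts [Real.rpow_nonneg (h0 _ _) _, zero_le_one])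
  have hprod : ∀ y : Fin L → Fin N → Y,
      (∑ a, (∏ r, ∏ i, p (a r i)) * (likelihood W L a y * likelihood W k a y ^ (-s))) *
        (∑ a, (∏ r, ∏ i, p (a r i)) * likelihood W k a y ^ (s / ρ)) ^ ρ =
      ∏ r : Fin L, ∏ i : Fin N,
        ((∑ x, p x * if r.val < k then W x (y r i) ^ (1 - s) else W x (y r i)) *
          (∑ x, p x * if r.val < k then W x (y r i) ^ (s / ρ) else 1) ^ ρ) := fun y => by
    rw [hA, hB, ← Real.finsetProd_rpow _ _
      fun r _ => Finset.prod_nonneg fun i _ => hB0 r (y r i), ← Finset.prod_mul_distrib]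
    refine Finset.prod_congr rfl fun r _ => ?_
    rw [← Real.finsetProd_rpow _ _ fun i _ => hB0 r (y r i), ← Finset.prod_mul_distrib]
  simp only [hprod]
  rw [sum_pi_pi_prod (fun (r : Fin L) (_ : Fin N) y =>
    (∑ x, p x * if r.val < k then W x y ^ (1 - s) else W x y) *
      (∑ x, p x * if r.val < k then W x y ^ (s / ρ) else 1) ^ ρ)]
  -- Rounds after the k-th are not tilted and integrate to 1, so exactly kN factors G survive.
  have hr : ∀ r : Fin L, ∑ y, (∑ x, p x * if r.val < k then W x y ^ (1 - s) else W x y) *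
      (∑ x, p x * if r.val < k then W x y ^ (s / ρ) else 1) ^ ρ = if r.val < k then G else 1 :=
    fun r => by
      split_ifs
      · rfl
      · simp only [mul_one, hp.2, Real.one_rpow]
        rw [Finset.sum_comm]
        simp only [← Finset.mul_sum, h1, mul_one, hp.2]
  simp only [hr, Finset.prod_const, Finset.card_univ, Fintype.card_fin, ite_pow, one_pow]
  rw [Finset.prod_ite, Finset.prod_const, Finset.prod_const_one, mul_one, Fin.card_filter_val_lt,
    min_eq_right hk, ← pow_mul, mul_comm]

/-- The probability of an undetected error after the first round is at most `e^{-Nt}`. -/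
theorem mean_undetected_le {n : ℕ} (h0 : ∀ x y, 0 ≤ W x y) (h1 : ∀ x, ∑ y, W x y = 1)
    (hp : p ∈ stdSimplex ℝ X) (hM : 0 < M) (t : ℝ) :
    mean W p (M := M) (L := n + 1) (N := N) (fun c m y =>
      open Classical in
      if ∃ m', m' ≠ m ∧ erasureDecode W 1 t c y = some m' then 1 else 0) ≤
      Real.exp (-(N * t)) := by
  classical
  have hM' : (M : ℝ) ≠ 0 := by positivity
  -- The bound holds for each code separately; averaging over codes is not needed.
  suffices h : ∀ c : Fin M → Fin (n + 1) → Fin N → X, ∑ m, ∑ y : Fin (n + 1) → Fin N → Y,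
      likelihood W (n + 1) (c m) y *
        (if ∃ m', m' ≠ m ∧ erasureDecode W 1 t c y = some m' then 1 else 0) ≤
      M * Real.exp (-(N * t)) by
    calc _ ≤ ∑ c : Fin M → Fin (n + 1) → Fin N → X, (∏ m, ∏ r, ∏ i, p (c m r i)) *
          ((1 / (M : ℝ)) * (M * Real.exp (-(N * t)))) :=
          Finset.sum_le_sum fun c _ => mul_le_mul_of_nonneg_left
            (mul_le_mul_of_nonneg_left (h c) (by positivity)) (code_prob_nonneg hp c)
      _ = _ := by
          rw [← Finset.sum_mul, sum_code_prob hp]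
          field_simp
  intro c
  set D : (Fin N → Y) → Option (Fin M) := fun b => erasureDecode W 1 t c fun _ => b with hD
  set w : Fin M → (Fin N → Y) → ℝ := fun m b => ∏ i, W (c m 0 i) (b i) with hw
  have hw0 : ∀ m b, 0 ≤ w m b := fun m b => Finset.prod_nonneg fun i _ => h0 _ _
  have hsplit : ∀ m, ∑ y : Fin (n + 1) → Fin N → Y, likelihood W (n + 1) (c m) y *
      (if ∃ m', m' ≠ m ∧ erasureDecode W 1 t c y = some m' then 1 else 0) =
      ∑ b, w m b * (if ∃ m', m' ≠ m ∧ D b = some m' then 1 else 0) := by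
    intro m
    rw [← (Fin.consEquiv (fun _ => Fin N → Y)).sum_comp, Fintype.sum_prod_type]
    refine Finset.sum_congr rfl fun b _ => ?_
    have e1 : ∀ y' : Fin n → Fin N → Y,
        erasureDecode W 1 t c (Fin.consEquiv (fun _ => Fin N → Y) (b, y')) = D b := fun y' =>
      erasureDecode_congr fun m => by simp [likelihood_one, Fin.consEquiv]
    have e2 : ∀ y' : Fin n → Fin N → Y,
        likelihood W (n + 1) (c m) (Fin.consEquiv (fun _ => Fin N → Y) (b, y'))
          = w m b * ∏ r, ∏ i, W (c m (Fin.succ r) i) (y' r i) := fun y' => by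
      rw [likelihood_full, Fin.prod_univ_succ]
      simp [hw, Fin.consEquiv]
    simp only [e1, e2]
    rw [← Finset.sum_mul, ← Finset.mul_sum,
      sum_pi_pi_prod (fun (r : Fin n) i y => W (c m r.succ i) y)]
    simp [h1]
  simp only [hsplit]
  rw [Finset.sum_comm]
  -- For fixed first-round outputs the decision is a single m', wrong for all other messages. The
  -- region inequality bounds their total likelihood by e^{-Nt} times that of m'.
  have hb : ∀ b, ∑ m, w m b * (if ∃ m', m' ≠ m ∧ D b = some m' then 1 else 0) ≤
      Real.exp (-(N * t)) * ∑ m, w m b := by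
    intro b
    have hsum0 : 0 ≤ ∑ m, w m b := Finset.sum_nonneg fun m _ => hw0 m b
    rcases hDb : D b with _ | m'
    · simpa using mul_nonneg (Real.exp_pos (-(N * t))).le hsum0
    · have hreg := inRegion_of_erasureDecode hDb
      simp only [InRegion, likelihood_one, Nat.cast_one, one_mul] at hreg
      have e : ∑ m, w m b * (if ∃ m'', m'' ≠ m ∧ some m' = some m'' then 1 else 0)
          = ∑ m ∈ Finset.univ.erase m', w m b := by
        rw [← Finset.add_sum_erase _ _ (Finset.mem_univ m')]
        rw [if_neg (by simp), mul_zero, zero_add]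
        refine Finset.sum_congr rfl fun m hm => ?_
        rw [if_pos ⟨m', (Finset.ne_of_mem_erase hm).symm, rfl⟩, mul_one]
      rw [e, Real.exp_neg, inv_mul_eq_div, le_div_iff₀ (Real.exp_pos _), mul_comm]
      exact hreg.trans (Finset.single_le_sum (f := fun m => w m b) (fun m _ => hw0 m b)
        (Finset.mem_univ m'))
  refine (Finset.sum_le_sum fun b _ => hb b).trans (le_of_eq ?_)
  rw [← Finset.mul_sum, Finset.sum_comm]
  have : ∀ m, ∑ b, w m b = 1 := fun m => by
    simp only [hw]
    rw [sum_pi_prod (fun i y => W (c m 0 i) y)]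
    simp [h1]
  simp only [this]
  simp [mul_comm]

end Coding

/-! ### Thresholds for which decoding happens after the first or the last round only -/

/-- The threshold `t` after the first round, and a threshold that is never met afterwards. -/
def firstRoundThreshold (t : ℝ) : ℕ → ℝ := fun k => if k = 1 then t else 2

section Scheme

variable {X : Type u} {Y : Type v} {W : X → Y → ℝ} {p : X → ℝ} {M L N : ℕ}

/-- Likelihoods of two codewords differ by a factor of at most 3 per symbol, while the threshold
demands e² > 3 per symbol. A rival must exist (M ≥ 2) and the outputs must be possible, since
otherwise the sum over rivals is 0 and the region condition is trivial. -/
theorem erasureDecode_two_eq_none (h0 : ∀ x y, 0 ≤ W x y) (h3 : ∀ x x' y, W x y ≤ 3 * W x' y)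
    (hM : 2 ≤ M) (hN : 1 ≤ N) {k : ℕ} (hk : 1 ≤ k) {c : Fin M → Fin L → Fin N → X} {m : Fin M}
    {y : Fin L → Fin N → Y} (hpos : 0 < likelihood W L (c m) y) :
    erasureDecode W k 2 c y = none := by
  rcases hdec : erasureDecode W k 2 c y with _ | m'
  · rfl
  exfalso
  have hreg := inRegion_of_erasureDecode hdec
  have hW : ∀ x r i, 0 < W x (y r i) := by
    intro x r i
    have h : W (c m r i) (y r i) ≠ 0 := by
      intro h
      rw [likelihood_full] at hpos
      exact hpos.ne' (Finset.prod_eq_zero (Finset.mem_univ r)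
        (Finset.prod_eq_zero (Finset.mem_univ i) h))
    have := (h0 _ _).lt_of_ne' h
    linarith [h3 (c m r i) x (y r i)]
  have hl : ∀ x : Fin L → Fin N → X, 0 < likelihood W k x y := fun x =>
    Finset.prod_pos fun r _ => Finset.prod_pos fun i _ => hW _ _ _
  have : Nontrivial (Fin M) := Fin.nontrivial_iff_two_le.2 hM
  obtain ⟨j, hj⟩ := exists_ne m'
  have hratio : likelihood W k (c m') y ≤ 3 ^ (N * k) * likelihood W k (c j) y := by
    calc likelihood W k (c m') y
        ≤ ∏ r ∈ Finset.univ.filter (fun r : Fin L => r.val < k),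
          (3 ^ N * ∏ i, W (c j r i) (y r i)) := by
          refine Finset.prod_le_prod (fun r _ => Finset.prod_nonneg fun i _ => h0 _ _)
            fun r _ => ?_
          calc _ ≤ ∏ i, 3 * W (c j r i) (y r i) :=
                Finset.prod_le_prod (fun i _ => h0 _ _) fun i _ => h3 _ _ _
            _ = _ := by rw [Finset.prod_mul_distrib]; simp
      _ = 3 ^ (N * min L k) * likelihood W k (c j) y := by
          rw [Finset.prod_mul_distrib, Finset.prod_const, Fin.card_filter_val_lt, ← pow_mul,
            likelihood]
      _ ≤ _ := by
          refine mul_le_mul_of_nonneg_right ?_ (hl _).le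
          exact pow_le_pow_right₀ (by norm_num) (Nat.mul_le_mul_left _ (min_le_right _ _))
  have hsingle : likelihood W k (c j) y ≤ ∑ i ∈ Finset.univ.erase m', likelihood W k (c i) y :=
    Finset.single_le_sum (f := fun i => likelihood W k (c i) y) (fun i _ => (hl _).le)
      (Finset.mem_erase.2 ⟨hj, Finset.mem_univ j⟩)
  have hexp : (3 : ℝ) ^ (N * k) < Real.exp (k * N * 2) := by
    have h3e : (3 : ℝ) < Real.exp 2 := by
      have := Real.add_one_lt_exp (by norm_num : (2 : ℝ) ≠ 0)
      linarith
    calc (3 : ℝ) ^ (N * k) < Real.exp 2 ^ (N * k) :=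
          pow_lt_pow_left₀ h3e (by norm_num) (Nat.mul_ne_zero (by omega) (by omega))
      _ = _ := by rw [← Real.exp_nat_mul]; congr 1; push_cast; ring
  have h4 : Real.exp (k * N * 2) * likelihood W k (c j) y ≤ 3 ^ (N * k) * likelihood W k (c j) y :=
    (mul_le_mul_of_nonneg_left hsingle (Real.exp_pos _).le).trans (hreg.trans hratio)
  exact absurd (le_of_mul_le_mul_right h4 (hl _)) (not_le.2 hexp)

theorem rounds_firstRoundThreshold (h0 : ∀ x y, 0 ≤ W x y) (h3 : ∀ x x' y, W x y ≤ 3 * W x' y)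
    (hM : 2 ≤ M) (hN : 1 ≤ N) (hL : 2 ≤ L) (t : ℝ) {c : Fin M → Fin L → Fin N → X} {m : Fin M}
    {y : Fin L → Fin N → Y} (hpos : 0 < likelihood W L (c m) y) :
    rounds W (firstRoundThreshold t) c y = if erasureDecode W 1 t c y = none then L else 1 := by
  have hset : ∀ k, ((1 ≤ k ∧ k < L ∧
      erasureDecode W k (firstRoundThreshold t k) c y ≠ none) ∨ k = L) ↔
      ((k = 1 ∧ erasureDecode W 1 t c y ≠ none) ∨ k = L) := by
    intro k
    refine or_congr_left ?_
    constructor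
    · rintro ⟨h1, h2, h⟩
      rcases eq_or_ne k 1 with rfl | hk
      · exact ⟨rfl, by simpa [firstRoundThreshold] using h⟩
      · rw [firstRoundThreshold, if_neg hk] at h
        exact absurd (erasureDecode_two_eq_none h0 h3 hM hN h1 hpos) h
    · rintro ⟨rfl, h⟩
      exact ⟨le_rfl, by omega, by simpa [firstRoundThreshold] using h⟩
  rw [rounds]
  simp only [hset]
  split_ifs with h
  · simp [h]
  · refine le_antisymm (Nat.sInf_le (Or.inl ⟨rfl, h⟩)) ?_
    refine le_csInf ⟨1, Or.inl ⟨rfl, h⟩⟩ ?_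
    rintro k (⟨rfl, -⟩ | rfl)
    · exact le_rfl
    · omega

variable [Fintype X] [Fintype Y]

theorem prError_le_one (h0 : ∀ x y, 0 ≤ W x y) (h1 : ∀ x, ∑ y, W x y = 1)
    (hp : p ∈ stdSimplex ℝ X) (hM : 0 < M) (T : ℕ → ℝ) : prError W p L N M T ≤ 1 := by
  rw [← mean_const (N := N) (L := L) h1 hp hM 1]
  refine mean_mono h0 hp fun c m y _ => ?_
  split_ifs <;> norm_num

/-- An error is either undetected in the first round or made by maximum likelihood at the end. The
latter forces some rival, hence the sum of the rivals, to be at least as likely as the truth; that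
event is bounded with threshold 0, s = 1/2 and ρ = 1, without using that the first round was erased.
-/
theorem prError_firstRoundThreshold_le (h0 : ∀ x y, 0 ≤ W x y) (h1 : ∀ x, ∑ y, W x y = 1)
    (h3 : ∀ x x' y, W x y ≤ 3 * W x' y) (hp : p ∈ stdSimplex ℝ X) (hM : 2 ≤ M) (hN : 1 ≤ N)
    (hL : 2 ≤ L) (t : ℝ) :
    prError W p L N M (firstRoundThreshold t) ≤
      Real.exp (-(N * t)) + M * Real.exp (-(L * N * Eo W (1 / 2) 1 p)) := by
  classical
  obtain ⟨n, rfl⟩ : ∃ n, L = n + 1 := ⟨L - 1, by omega⟩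
  have hM0 : 0 < M := by omega
  have hU := mean_undetected_le (N := N) (n := n) h0 h1 hp hM0 t
  have hE := mean_indicator_le (N := N) (L := n + 1) h0 h1 hp hM0 le_rfl (s := 1 / 2) (ρ := 1)
    (by norm_num) (by norm_num) (by norm_num) le_rfl 0
  simp only [mul_zero, Real.exp_zero, one_mul, Real.rpow_one] at hE
  refine le_trans ?_ (add_le_add hU hE)
  rw [← mean_add]
  refine mean_mono h0 hp fun c m y hpos => ?_
  have hr := rounds_firstRoundThreshold h0 h3 hM hN hL t hpos
  have hnn : ∀ P : Prop, ∀ [Decidable P], (0 : ℝ) ≤ if P then 1 else 0 := fun P _ => by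
    split_ifs <;> norm_num
  split_ifs with hd h2 h4 h4 h2 h4 h4 <;> try norm_num
  exfalso
  by_cases hnone : erasureDecode W 1 t c y = none
  · rw [if_pos hnone] at hr
    have hex : ∃ m', ∀ i, likelihood W (n + 1) (c i) y ≤ likelihood W (n + 1) (c m') y := by
      have : Nonempty (Fin M) := ⟨m⟩
      exact Finite.exists_max fun i => likelihood W (n + 1) (c i) y
    rw [decision, hr, if_neg (lt_irrefl _), mlDecode, dif_pos hex] at hd
    have hne : hex.choose ≠ m := fun h => hd (congrArg some h)
    refine h4 ((hex.choose_spec m).trans ?_)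
    exact Finset.single_le_sum (f := fun i => likelihood W (n + 1) (c i) y)
      (fun i _ => likelihood_nonneg h0 _ _ _) (Finset.mem_erase.2 ⟨hne, Finset.mem_univ _⟩)
  · rw [if_neg hnone] at hr
    rw [decision, hr, if_pos (by omega), firstRoundThreshold, if_pos rfl] at hd
    obtain ⟨m', hm'⟩ := Option.ne_none_iff_exists'.1 hnone
    exact h2 ⟨m', fun h => hd (h ▸ hm'), hm'⟩

theorem le_avgDelay_firstRoundThreshold (h0 : ∀ x y, 0 ≤ W x y) (h1 : ∀ x, ∑ y, W x y = 1)
    (h3 : ∀ x x' y, W x y ≤ 3 * W x' y) (hp : p ∈ stdSimplex ℝ X) (hM : 2 ≤ M) (hN : 1 ≤ N)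
    (hL : 2 ≤ L) (t : ℝ) : (N : ℝ) ≤ avgDelay W p L N M (firstRoundThreshold t) := by
  rw [← mean_const (N := N) (L := L) h1 hp (by omega : 0 < M) (N : ℝ)]
  refine mean_mono h0 hp fun c m y hpos => ?_
  rw [rounds_firstRoundThreshold h0 h3 hM hN hL t hpos]
  refine le_mul_of_one_le_right (Nat.cast_nonneg _) ?_
  split_ifs
  · exact_mod_cast (by omega : 1 ≤ L)
  · simp

/-- Delay beyond N occurs only if the first round is erased, and then the true message in particular
misses its region. That event has the random coding bound with k = 1 and costs at most NL. -/
theorem avgDelay_firstRoundThreshold_le (h0 : ∀ x y, 0 ≤ W x y) (h1 : ∀ x, ∑ y, W x y = 1)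
    (h3 : ∀ x x' y, W x y ≤ 3 * W x' y) (hp : p ∈ stdSimplex ℝ X) (hM : 2 ≤ M) (hN : 1 ≤ N)
    (hL : 2 ≤ L) (t : ℝ) {s ρ : ℝ} (hs : 0 < s) (hs1 : s < 1) (hsρ : s ≤ ρ) (hρ : ρ ≤ 1) :
    avgDelay W p L N M (firstRoundThreshold t) ≤
      N + N * L * (Real.exp (s * (N * t)) * M ^ ρ * Real.exp (-(N * Eo W s ρ p))) := by
  classical
  have hM0 : 0 < M := by omega
  have hE := mean_indicator_le (N := N) (L := L) h0 h1 hp hM0 (k := 1) (by omega) hs hs1 hsρ hρ t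
  simp only [Nat.cast_one, one_mul] at hE
  refine le_trans ?_ (add_le_add_right (mul_le_mul_of_nonneg_left hE (by positivity)) _)
  rw [← mean_const_mul]
  refine le_trans ?_ (add_le_add (mean_const (N := N) (L := L) h1 hp hM0 (N : ℝ)).le le_rfl)
  rw [← mean_add]
  refine mean_mono h0 hp fun c m y hpos => ?_
  rw [rounds_firstRoundThreshold h0 h3 hM hN hL t hpos]
  have hNL : (0 : ℝ) ≤ N * L := by positivity
  have hN0 : (0 : ℝ) ≤ N := by positivity
  split_ifs with hnone h h
  · linarith
  · exfalso
    have hnot : ¬ ∃ m, InRegion W 1 t c y m := by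
      intro hex
      rw [erasureDecode, dif_pos hex] at hnone
      exact Option.some_ne_none _ hnone
    refine h (le_of_lt ?_)
    have := not_exists.1 hnot m
    simpa [InRegion] using this
  · simpa using hNL
  · simp

theorem avgDelay_firstRoundThreshold_two (h0 : ∀ x y, 0 ≤ W x y) (h1 : ∀ x, ∑ y, W x y = 1)
    (h3 : ∀ x x' y, W x y ≤ 3 * W x' y) (hp : p ∈ stdSimplex ℝ X) (hM : 2 ≤ M) (hN : 1 ≤ N)
    (hL : 2 ≤ L) : avgDelay W p L N M (firstRoundThreshold 2) = N * L := by
  have hr : ∀ (c : Fin M → Fin L → Fin N → X) m y, 0 < likelihood W L (c m) y →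
      (N : ℝ) * rounds W (firstRoundThreshold 2) c y = N * L := fun c m y hpos => by
    rw [rounds_firstRoundThreshold h0 h3 hM hN hL 2 hpos,
      if_pos (erasureDecode_two_eq_none h0 h3 hM hN le_rfl hpos)]
  rw [← mean_const (N := N) (L := L) h1 hp (by omega : 0 < M) ((N : ℝ) * L)]
  exact le_antisymm (mean_mono h0 hp fun c m y hpos => (hr c m y hpos).le)
    (mean_mono h0 hp fun c m y hpos => (hr c m y hpos).ge)

end Scheme

/-! ### Numbers of messages of a given exponential rate -/

/-- A number of messages of rate `R` per symbol, for `N` symbols. -/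
def messages (R : ℝ) (N : ℕ) : ℕ := ⌈Real.exp (N * R)⌉₊ + N

/-- The summand N in `messages` serves this purpose: at R = 0 the ceiling is constantly 1. -/
theorem tendsto_messages (R : ℝ) : Tendsto (messages R) atTop atTop :=
  tendsto_atTop_mono (fun N => Nat.le_add_left N _) tendsto_id

theorem exp_le_messages (R : ℝ) (N : ℕ) : Real.exp (N * R) ≤ messages R N := by
  rw [messages]; push_cast
  linarith [Nat.le_ceil (Real.exp (N * R)), (Nat.cast_nonneg N : (0 : ℝ) ≤ N)]

theorem messages_le {R : ℝ} (hR : 0 ≤ R) (N : ℕ) :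
    (messages R N : ℝ) ≤ (N + 2) * Real.exp (N * R) := by
  rw [messages]; push_cast
  have h1 := Nat.ceil_lt_add_one (Real.exp_pos (N * R)).le
  have h2 : 1 ≤ Real.exp (N * R) := Real.one_le_exp (by positivity)
  nlinarith [(Nat.cast_nonneg N : (0 : ℝ) ≤ N)]

theorem tendsto_add_two_mul_exp {κ : ℝ} (hκ : 0 < κ) :
    Tendsto (fun N : ℕ => ((N : ℝ) + 2) * Real.exp (-(N * κ))) atTop (𝓝 0) := by
  have h1 : Tendsto (fun x : ℝ => x ^ (1 : ℝ) * Real.exp (-κ * x)) atTop (𝓝 0) :=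
    tendsto_rpow_mul_exp_neg_mul_atTop_nhds_zero 1 κ hκ
  have h2 : Tendsto (fun x : ℝ => x ^ (0 : ℝ) * Real.exp (-κ * x)) atTop (𝓝 0) :=
    tendsto_rpow_mul_exp_neg_mul_atTop_nhds_zero 0 κ hκ
  have h3 := ((h1.add (h2.const_mul 2)).comp tendsto_natCast_atTop_atTop)
  simp only [mul_zero, add_zero] at h3
  refine h3.congr fun N => ?_
  simp only [Function.comp, Real.rpow_one, Real.rpow_zero]
  rw [show -κ * (N : ℝ) = -(N * κ) by ring]
  ring

theorem tendsto_log_messages_div {R : ℝ} (hR : 0 ≤ R) :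
    Tendsto (fun N : ℕ => Real.log (messages R N) / N) atTop (𝓝 R) := by
  have hlog : Tendsto (fun N : ℕ => R + (Real.log N / N + Real.log 3 / N)) atTop (𝓝 R) := by
    have h1 : Tendsto (fun N : ℕ => Real.log N / N) atTop (𝓝 0) := by
      have := (Real.isLittleO_log_id_atTop.tendsto_div_nhds_zero).comp
        (tendsto_natCast_atTop_atTop (R := ℝ))
      exact this
    have h2 := tendsto_const_div_atTop_nhds_zero_nat (Real.log 3)
    simpa using (h1.add h2).const_add R
  refine tendsto_of_tendsto_of_tendsto_of_le_of_le' tendsto_const_nhds hlog ?_ ?_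
  · filter_upwards [eventually_ge_atTop 1] with N hN
    have hN0 : (0 : ℝ) < N := by exact_mod_cast hN
    rw [le_div_iff₀ hN0]
    have := Real.log_le_log (Real.exp_pos _) (exp_le_messages R N)
    rw [Real.log_exp] at this
    linarith
  · filter_upwards [eventually_ge_atTop 1] with N hN
    have hN1 : (1 : ℝ) ≤ N := by exact_mod_cast hN
    have hN0 : (0 : ℝ) < N := by linarith
    have hpos : (0 : ℝ) < messages R N := (Real.exp_pos _).trans_le (exp_le_messages R N)
    have h1 : Real.log (messages R N) ≤ Real.log (N * 3 * Real.exp (N * R)) := by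
      refine Real.log_le_log hpos ((messages_le hR N).trans ?_)
      exact mul_le_mul_of_nonneg_right (by linarith) (Real.exp_pos _).le
    rw [Real.log_mul (by positivity) (Real.exp_pos _).ne', Real.log_exp,
      Real.log_mul hN0.ne' (by norm_num)] at h1
    rw [div_le_iff₀ hN0]
    have : (R + (Real.log N / N + Real.log 3 / N)) * N = N * R + (Real.log N + Real.log 3) := by
      field_simp
    linarith

/-! ### The exponent achieved by decoding in the first or the last round. -/

section Exponent

variable {X : Type u} {Y : Type v} [Fintype X] [Fintype Y] {W : X → Y → ℝ} {p : X → ℝ}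

theorem firstRoundThreshold_nonneg {t : ℝ} (ht : 0 ≤ t) (k : ℕ) : 0 ≤ firstRoundThreshold t k := by
  rw [firstRoundThreshold]
  split_ifs <;> linarith

/-- A scheme that always waits for the last round is admissible: its delay is exactly NL, so
messages of rate LR per symbol of one round give average rate R. It covers targets that are not
positive. -/
theorem irExponent_nonneg (h0 : ∀ x y, 0 ≤ W x y) (h1 : ∀ x, ∑ y, W x y = 1)
    (h3 : ∀ x x' y, W x y ≤ 3 * W x' y) (hp : p ∈ stdSimplex ℝ X) {R : ℝ} (hR : 0 ≤ R) {L : ℕ}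
    (hL : 2 ≤ L) : 0 ≤ irExponent W p R L := by
  have hL0 : (0 : ℝ) < L := by exact_mod_cast (by omega : 0 < L)
  refine le_trans ?_ (le_sSup ⟨messages (L * R), firstRoundThreshold 2,
    firstRoundThreshold_nonneg (by norm_num), tendsto_messages _, ?_, rfl⟩)
  · refine le_limsup_of_frequently_le (Eventually.frequently ?_)
    filter_upwards [eventually_ge_atTop 2] with N hN
    have hM : 2 ≤ messages (L * R) N := hN.trans (Nat.le_add_left N _)
    rw [avgDelay_firstRoundThreshold_two h0 h1 h3 hp hM (by omega) hL]
    refine EReal.div_nonneg ?_ (by exact_mod_cast (by positivity : (0 : ℝ) ≤ N * L))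
    rw [EReal.neg_nonneg, ← ENNReal.log_one]
    refine ENNReal.log_monotone ?_
    rw [← ENNReal.ofReal_one]
    exact ENNReal.ofReal_le_ofReal (prError_le_one h0 h1 hp (by omega) _)
  · have := (tendsto_log_messages_div (R := L * R) (by positivity)).div_const (L : ℝ)
    rw [mul_div_cancel_left₀ _ hL0.ne'] at this
    refine this.congr' ?_
    filter_upwards [eventually_ge_atTop 2] with N hN
    have hM : 2 ≤ messages (L * R) N := hN.trans (Nat.le_add_left N _)
    rw [avgDelay_firstRoundThreshold_two h0 h1 h3 hp hM (by omega) hL, div_div]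

/-- IR-ARQ achieves every exponent below the threshold `t` of the first round and below the
exponent of the last round, if the first round is erased with small probability. -/
theorem le_irExponent (h0 : ∀ x y, 0 ≤ W x y) (h1 : ∀ x, ∑ y, W x y = 1)
    (h3 : ∀ x x' y, W x y ≤ 3 * W x' y) (hp : p ∈ stdSimplex ℝ X) {R : ℝ} (hR : 0 ≤ R) {L : ℕ}
    (hL : 2 ≤ L) {t s ρ v : ℝ} (hs : 0 < s) (hs1 : s < 1) (hsρ : s ≤ ρ) (hρ : ρ ≤ 1)
    (hE : ρ * R + s * t < Eo W s ρ p) (hv : 0 ≤ v) (hvt : v < t)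
    (hvL : v < L * Eo W (1 / 2) 1 p - R) : (v : EReal) ≤ irExponent W p R L := by
  -- The gap above w absorbs the polynomial factors N + 2; the gap between v and w absorbs the ratio
  -- of the delay to N.
  obtain ⟨w, hvw, hw⟩ := exists_between (lt_min hvt hvL)
  have hwt : w < t := hw.trans_le (min_le_left _ _)
  have hwL : w < L * Eo W (1 / 2) 1 p - R := hw.trans_le (min_le_right _ _)
  set κ := Eo W s ρ p - ρ * R - s * t with hκdef
  have hκ : 0 < κ := by linarith
  set B : ℕ → ℝ := fun N => ((N : ℝ) + 2) * Real.exp (-(N * κ)) with hB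
  have hB0 : Tendsto B atTop (𝓝 0) := tendsto_add_two_mul_exp hκ
  have hB1 : Tendsto (fun N => 1 + L * B N) atTop (𝓝 1) := by
    simpa using (hB0.const_mul (L : ℝ)).const_add 1
  set τ : ℕ → ℝ := fun N => avgDelay W p L N (messages R N) (firstRoundThreshold t) with hτ
  have hM : ∀ N, 2 ≤ N → 2 ≤ messages R N := fun N hN => hN.trans (Nat.le_add_left N _)
  have hτge : ∀ᶠ N : ℕ in atTop, (N : ℝ) ≤ τ N := by
    filter_upwards [eventually_ge_atTop 2] with N hN
    exact le_avgDelay_firstRoundThreshold h0 h1 h3 hp (hM N hN) (by omega) hL t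
  have hτle : ∀ᶠ N : ℕ in atTop, τ N ≤ N * (1 + L * B N) := by
    filter_upwards [eventually_ge_atTop 2] with N hN
    refine (avgDelay_firstRoundThreshold_le h0 h1 h3 hp (hM N hN) (by omega) hL t hs hs1 hsρ
      hρ).trans ?_
    have hρ0 : 0 ≤ ρ := hs.le.trans hsρ
    have hN0 : (0 : ℝ) ≤ N := by positivity
    have e1 : (messages R N : ℝ) ^ ρ ≤ (N + 2) * Real.exp (ρ * (N * R)) := by
      calc (messages R N : ℝ) ^ ρ ≤ ((N + 2) * Real.exp (N * R)) ^ ρ :=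
            Real.rpow_le_rpow (by positivity) (messages_le hR N) hρ0
        _ = (N + 2) ^ ρ * Real.exp (ρ * (N * R)) := by
            rw [Real.mul_rpow (by positivity) (Real.exp_pos _).le, ← Real.exp_mul, mul_comm ρ]
        _ ≤ _ := by
            refine mul_le_mul_of_nonneg_right ?_ (Real.exp_pos _).le
            exact Real.rpow_le_self_of_one_le (by linarith) hρ
    have e2 : Real.exp (s * (N * t)) * (messages R N : ℝ) ^ ρ * Real.exp (-(N * Eo W s ρ p)) ≤
        B N := by
      calc _ ≤ Real.exp (s * (N * t)) * ((N + 2) * Real.exp (ρ * (N * R))) *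
            Real.exp (-(N * Eo W s ρ p)) := by gcongr
        _ = (N + 2) * (Real.exp (s * (N * t)) * Real.exp (ρ * (N * R)) *
            Real.exp (-(N * Eo W s ρ p))) := by ring
        _ = B N := by
            rw [← Real.exp_add, ← Real.exp_add, hB]
            simp only
            congr 2
            rw [hκdef]; ring
    calc _ ≤ (N : ℝ) + N * L * B N := by gcongr
      _ = _ := by ring
  have hratio : Tendsto (fun N : ℕ => τ N / N) atTop (𝓝 1) := by
    refine tendsto_of_tendsto_of_tendsto_of_le_of_le' tendsto_const_nhds hB1 ?_ ?_
    · filter_upwards [eventually_ge_atTop 1, hτge] with N hN h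
      rw [le_div_iff₀ (by exact_mod_cast hN)]
      linarith
    · filter_upwards [eventually_ge_atTop 1, hτle] with N hN h
      rw [div_le_iff₀ (by exact_mod_cast hN)]
      linarith
  refine le_trans ?_ (le_sSup ⟨messages R, firstRoundThreshold t,
    firstRoundThreshold_nonneg (hv.trans hvt.le), tendsto_messages _, ?_, rfl⟩)
  · refine le_limsup_of_frequently_le (Eventually.frequently ?_)
    have hsmall : ∀ᶠ N : ℕ in atTop, ((N : ℝ) + 2) * Real.exp (-(N * (t - w))) +
        ((N : ℝ) + 2) * Real.exp (-(N * (L * Eo W (1 / 2) 1 p - R - w))) < 1 := by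
      have := (tendsto_add_two_mul_exp (sub_pos.2 hwt)).add
        (tendsto_add_two_mul_exp (sub_pos.2 hwL))
      rw [add_zero] at this
      exact this.eventually_lt_const one_pos
    have hdelay : ∀ᶠ N : ℕ in atTop, (1 + L * B N) * v < w := by
      have := hB1.mul_const v
      rw [one_mul] at this
      exact this.eventually_lt_const hvw
    filter_upwards [eventually_ge_atTop 2, hτge, hτle, hsmall, hdelay] with N hN hge hle hsm hde
    have hN0 : (0 : ℝ) < N := by exact_mod_cast (by omega : 0 < N)
    have hτ0 : 0 < τ N := hN0.trans_le hge
    have hpr : prError W p L N (messages R N) (firstRoundThreshold t) ≤ Real.exp (-(v * τ N)) := by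
      have e0 := prError_firstRoundThreshold_le h0 h1 h3 hp (hM N hN) (by omega : 1 ≤ N) hL t
      have e1 : Real.exp (-(N * t)) ≤
          Real.exp (-(N * w)) * (((N : ℝ) + 2) * Real.exp (-(N * (t - w)))) := by
        have : Real.exp (-(N * t)) = Real.exp (-(N * w)) * (1 * Real.exp (-(N * (t - w)))) := by
          rw [one_mul, ← Real.exp_add]; congr 1; ring
        rw [this]
        gcongr
        linarith
      have e2 : (messages R N : ℝ) * Real.exp (-(L * N * Eo W (1 / 2) 1 p)) ≤
          Real.exp (-(N * w)) *
            (((N : ℝ) + 2) * Real.exp (-(N * (L * Eo W (1 / 2) 1 p - R - w)))) := by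
        calc _ ≤ ((N + 2) * Real.exp (N * R)) * Real.exp (-(L * N * Eo W (1 / 2) 1 p)) := by
              gcongr; exact messages_le hR N
          _ = (N + 2) * (Real.exp (N * R) * Real.exp (-(L * N * Eo W (1 / 2) 1 p))) := by ring
          _ = (N + 2) * (Real.exp (-(N * w)) *
              Real.exp (-(N * (L * Eo W (1 / 2) 1 p - R - w)))) := by
              rw [← Real.exp_add, ← Real.exp_add]; congr 2; ring
          _ = _ := by ring
      have e3 : v * τ N ≤ N * w := by
        calc v * τ N ≤ v * (N * (1 + L * B N)) := mul_le_mul_of_nonneg_left hle hv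
          _ = N * ((1 + L * B N) * v) := by ring
          _ ≤ N * w := by gcongr
      have e4 : Real.exp (-(N * w)) ≤ Real.exp (-(v * τ N)) :=
        Real.exp_le_exp.2 (neg_le_neg e3)
      have e5 := mul_le_mul_of_nonneg_left hsm.le (Real.exp_pos (-(N * w))).le
      linarith
    -- The comparison goes through the monotone `ENNReal.log`, so a vanishing error probability
    -- needs no separate case.
    rw [EReal.le_div_iff_mul_le (by exact_mod_cast hτ0) (EReal.coe_ne_top _)]
    rw [← EReal.coe_mul, EReal.le_neg, ← EReal.coe_neg]
    calc _ ≤ ENNReal.log (ENNReal.ofReal (Real.exp (-(v * τ N)))) :=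
          ENNReal.log_monotone (ENNReal.ofReal_le_ofReal hpr)
      _ = _ := by rw [ENNReal.log_ofReal_of_pos (Real.exp_pos _), Real.log_exp]
  · have := (tendsto_log_messages_div hR).div hratio one_ne_zero
    rw [div_one] at this
    refine this.congr' ?_
    filter_upwards [eventually_ge_atTop 1] with N hN
    have hN0 : (N : ℝ) ≠ 0 := by exact_mod_cast (by omega : N ≠ 0)
    simp only [Pi.div_apply]
    rw [div_div_div_cancel_right₀ hN0]

theorem HasNoisyExponents.le_irExponent {δ : ℝ} (h : HasNoisyExponents W p (δ / 8)) (hδ : 0 < δ)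
    (hδ1 : δ ≤ 1) (h0 : ∀ x y, 0 ≤ W x y) (h1 : ∀ x, ∑ y, W x y = 1)
    (h3 : ∀ x x' y, W x y ≤ 3 * W x' y) {R : ℝ} (hR : 0 ≤ R) (hRC : R ≤ capacity W) :
    ((2 * capacity W - 2 * (√(capacity W) * √R) - 2 * δ * capacity W : ℝ) : EReal) ≤
      irExponent W p R 4 := by
  set v := 2 * capacity W - 2 * (√(capacity W) * √R) - 2 * δ * capacity W with hv
  rcases le_or_gt v 0 with hv0 | hv0
  · exact le_trans (by exact_mod_cast hv0) (irExponent_nonneg h0 h1 h3 h.mem hR (by norm_num))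
  have hC : 0 < capacity W := by
    refine h.capacity_nonneg.lt_of_ne fun hC => ?_
    rw [hv, ← hC] at hv0
    simp at hv0
  obtain ⟨s, ρ, hs, hs1, hsρ, hρ, hlt⟩ := exists_exponent_parameters hC hR hRC hδ hδ1
  have hδC : 0 < δ * capacity W := mul_pos hδ hC
  refine ARQ.le_irExponent h0 h1 h3 h.mem hR (by norm_num)
    (t := 2 * capacity W - 2 * (√(capacity W) * √R) - δ * capacity W) hs hs1 hsρ hρ
    (hlt.trans_le (h.le_Eo s ρ hs.le hsρ hρ)) hv0.le (by rw [hv]; linarith) ?_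
  -- Here s(2 - s - s/ρ) = 1/2, so four rounds give 2C up to a term δC/4. After subtracting R ≤ √C√R
  -- this still exceeds v.
  have h5 := h.le_Eo (1 / 2) 1 (by norm_num) (by norm_num) le_rfl
  have h6 : R ≤ √(capacity W) * √R := by
    calc R = √R * √R := (Real.mul_self_sqrt hR).symm
      _ ≤ _ := by gcongr
  push_cast
  rw [hv]
  linarith

theorem IsCentered.channel_bounds {q : Y → ℝ} {e : X → Y → ℝ} {θ : ℝ} (h : IsCentered W p q e θ)
    (hθ : θ ≤ 1 / 12) :
    (∀ x y, 0 ≤ W x y) ∧ (∀ x, ∑ y, W x y = 1) ∧ ∀ x x' y, W x y ≤ 3 * W x' y := by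
  refine ⟨fun x y => ?_, fun x => ?_, fun x x' y => ?_⟩
  · rw [h.eq]
    exact mul_nonneg (h.nonneg y) (h.one_add_pos hθ x y).le
  · simp only [h.eq, mul_add, mul_one, Finset.sum_add_distrib, h.sum_eq, h.sum_out, add_zero]
  · rw [h.eq, h.eq, mul_left_comm]
    refine mul_le_mul_of_nonneg_left ?_ (h.nonneg y)
    linarith [(abs_le.1 (h.bound x y)).2, (abs_le.1 (h.bound x' y)).1]

end Exponent

end ARQ

end

/-- Very noisy channels, deadline `L = 4`. The very noisy channel is the limit `η → 0` of channels
`p(j|k) = ω_j (1 + ε_{jk})`, `|ε_{jk}| ≤ η`, in which exponents are compared to leading order, i.e.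
up to an arbitrarily small fraction `δ` of the capacity. -/
theorem mainTheorem4 (δ : ℝ) (hδ : 0 < δ) :
    ∃ η : ℝ, 0 < η ∧
      ∀ (X : Type u) (Y : Type v) [Fintype X] [Fintype Y] (W : X → Y → ℝ) (p : X → ℝ),
        ARQ.IsVeryNoisy η W → ARQ.IsCapacityAchieving W p →
        ∀ R : ℝ, 0 ≤ R → R ≤ ARQ.capacity W →
          -- the feedback exponent of the very noisy channel
          ((((ARQ.capacity W - R) + (√(ARQ.capacity W) - √R) ^ 2
              - δ * ARQ.capacity W : ℝ) : EReal) ≤ ARQ.feedbackExponent W R ∧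
            ARQ.feedbackExponent W R ≤ (((ARQ.capacity W - R)
              + (√(ARQ.capacity W) - √R) ^ 2 + δ * ARQ.capacity W : ℝ) : EReal)) ∧
          -- incremental redundancy ARQ with deadline 4 achieves it
          ARQ.feedbackExponent W R ≤
            ARQ.irExponent W p R 4 + ((δ * ARQ.capacity W : ℝ) : EReal) := by
  -- The upper bound on the feedback exponent loses dC and the lower bound on the IR-ARQ exponent
  -- loses 2dC, hence the division by 3.
  set d := min δ 1 / 3 with hd
  have hd0 : 0 < d := div_pos (lt_min hδ one_pos) (by norm_num)
  have hd1 : d ≤ 1 := by linarith [min_le_right δ 1]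
  have hdδ : 3 * d ≤ δ := by linarith [min_le_left δ 1]
  -- The exponent functions are needed to relative accuracy d/8, which
  -- `IsVeryNoisy.hasNoisyExponents` provides at noise level (d/8)/400.
  refine ⟨d / 8 / 400, by positivity, fun X Y _ _ W p hW hp R hR hRC => ?_⟩
  have h := hW.hasNoisyExponents (δ := d / 8) (by positivity) (by linarith) rfl hp
  obtain ⟨q, e, hc⟩ := hW.exists_isCentered (by linarith) hp.1
  obtain ⟨h0, h1, h3⟩ := hc.channel_bounds (by linarith)
  have hC := h.capacity_nonneg
  have hlo := h.le_feedbackExponent hd0 hd1 hR hRC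
  have hhi := h.feedbackExponent_le (δ := d) (by positivity) (by linarith) hR hRC
  have hir := h.le_irExponent hd0 hd1 h0 h1 h3 hR hRC
  set C := ARQ.capacity W
  have hval : (C - R) + (√C - √R) ^ 2 = 2 * C - 2 * (√C * √R) := by
    linear_combination Real.mul_self_sqrt hC + Real.mul_self_sqrt hR
  have hdC : 3 * d * C ≤ δ * C := mul_le_mul_of_nonneg_right hdδ hC
  have hdC0 : 0 ≤ d * C := mul_nonneg hd0.le hC
  refine ⟨⟨le_trans ?_ hlo, hhi.trans ?_⟩, hhi.trans ?_⟩
  · rw [EReal.coe_le_coe_iff]; linarith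
  · rw [EReal.coe_le_coe_iff]; linarith
  · calc _ ≤ (((2 * C - 2 * (√C * √R) - 2 * d * C) + δ * C : ℝ) : EReal) := by
          rw [EReal.coe_le_coe_iff]; linarith
      _ ≤ _ := by
          rw [EReal.coe_add]
          gcongr
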